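/- Setting. Let $M$ be a complete, connected, non-compact smooth Riemannian manifold with distance $d$ and Riemannian volume $m$, and let $G$ be a group acting on $M$ by isometries, properly discontinuously (for all $x\in M$ and compact $K\subset M$, $gx\in K$ for only finitely many $g\in G$), cocompactly and freely. Let $(\Omega,\mathfrak A,\mathbb P)$ be a probability space with a measurable flow $(\theta_g)_{g\in G}$ (that is, $\theta_1=\mathrm{id}$, $\theta_g\circ\theta_h=\theta_{gh}$) that preserves $\mathbb P$. Let $\lambda^\bullet,\mu^\bullet$ be random measures on $M$ (measurable maps from $\Omega$ to the Radon measures on $M$) that are equivariant, i.e. $\lambda^{\theta_g\omega}(gB)=\lambda^\omega(B)$ for all $g\in G$, $\omega\in\Omega$ and Borel $B\subset M$, and likewise for $\mu^\bullet$; assume that almost surely $\lambda^\omega\ll m$ and $\lambda^\omega\neq 0$. Let $c(x,y)=\vartheta(d(x,y))$, where $\vartheta:[0,\infty)\to[0,\infty)$ is continuous and strictly increasing with $\vartheta(0)=0$ and $\lim_{r\to\infty}\vartheta(r)=\infty$, and assume that for any two compactly supported Borel probability measures $\lambda\ll m$ and $\mu$ on $M$ there is a unique coupling of $\lambda$ and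 $\mu$ that minimizes $\int c\,dq$, and that it is of the form $(\mathrm{id},T)_*\lambda$ with a measurable map $T$. A semicoupling of measures $\lambda,\mu$ on $M$ is a measure $q$ on $M\times M$ with $q(\cdot\times M)\le\lambda$ and $q(M\times\cdot)=\mu$; put $\mathsf{Cost}(q)=\int c\,dq$. For a random measure $\nu^\bullet$ write $(\nu^\bullet\mathbb P)(dx,d\omega)=\nu^\omega(dx)\,\mathbb P(d\omega)$. A semicoupling of $\lambda^\bullet\mathbb P$ and $(1_A\mu^\bullet)\mathbb P$ is a measure $Q$ on $M\times M\times\Omega$ whose image under $(x,y,\omega)\mapsto(x,\omega)$ is at most $\lambda^\bullet\mathbb P$ and whose image under $(x,y,\omega)\mapsto(y,\omega)$ is $(1_A\mu^\bullet)\mathbb P$; put $\mathfrak{Cost}(Q)=\int c(x,y)\,Q(dx,dy,d\omega)$. Theorem. For every bounded Borel set $A\subset M$ there are a semicoupling $Q_A$ of $\lambda^\bullet\mathbb P$ and $(1_A\mu^\bullet)\mathbb P$ and a random measure $q_A^\bullet$ on $M\times M$ such that: (i) $Q_A$ minimizes $\mathfrak{Cost}$ among all semicouplings of $\lambda^\bullet\mathbb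 P$ and $(1_A\mu^\bullet)\mathbb P$; if the minimum is finite, then $Q_A$ is the unique minimizer. (ii) $Q_A(dx,dy,d\omega)=q_A^\omega(dx,dy)\,\mathbb P(d\omega)$, and for $\mathbb P$-a.e. $\omega$ the measure $q_A^\omega$ is the unique minimizer of $\mathsf{Cost}$ among the semicouplings of $\lambda^\omega$ and $1_A\mu^\omega$. Moreover, there are measurable functions $(x,\omega)\mapsto T^\omega(x)\in M$ and $(x,\omega)\mapsto\rho^\omega(x)\in[0,1]$ such that $q_A^\omega=(\mathrm{id},T^\omega)_*(\rho^\omega\lambda^\omega)$ for $\mathbb P$-a.e. $\omega$. (iii) $\mathfrak{Cost}(Q_A)=\int_\Omega\mathsf{Cost}(q_A^\omega)\,\mathbb P(d\omega)$. -/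

import Mathlib

open MeasureTheory Set Filter Topology Manifold Bundle
open scoped ENNReal NNReal Bundle Pointwise

noncomputable section

/-- The density `√(det g)` of the Riemannian volume in the chart `e`, at the point `y` of the
target of `e`: here `g i j` is the inner product of the `i`-th and the `j`-th coordinate vector
field of the chart. -/
def chartVolumeDensity (n : ℕ) {M : Type*} [TopologicalSpace M]
    [ChartedSpace (EuclideanSpace ℝ (Fin n)) M]
    [RiemannianBundle (fun x : M => TangentSpace (𝓡 n) x)]
    (e : OpenPartialHomeomorph M (EuclideanSpace ℝ (Fin n))) (y : EuclideanSpace ℝ (Fin n)) : ℝ :=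
  let coordinateVector : Fin n → TangentSpace (𝓡 n) (e.symm y) := fun i =>
    mfderiv (𝓡 n) (𝓡 n) e.symm y (EuclideanSpace.single i (1 : ℝ))
  √(Matrix.det (Matrix.of fun i j : Fin n =>
    inner ℝ (coordinateVector i) (coordinateVector j)))

/-- The Riemannian volume of the domain of the chart `e`, as a measure on `M`: the measure
`√(det g) dy` on the target of the chart, transported to the manifold. -/
def chartVolume (n : ℕ) {M : Type*} [TopologicalSpace M]
    [ChartedSpace (EuclideanSpace ℝ (Fin n)) M]
    [RiemannianBundle (fun x : M => TangentSpace (𝓡 n) x)] [MeasurableSpace M]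
    (e : OpenPartialHomeomorph M (EuclideanSpace ℝ (Fin n))) : Measure M :=
  ((volume.restrict e.target).withDensity
    (fun y => ENNReal.ofReal (chartVolumeDensity n e y))).map e.symm

/-- The Riemannian volume measure. The measures `chartVolume n e` agree on overlaps, and their
supremum (the least measure that dominates all of them) is the measure obtained by gluing them. -/
def riemannianVolume (n : ℕ) (M : Type*) [TopologicalSpace M]
    [ChartedSpace (EuclideanSpace ℝ (Fin n)) M]
    [RiemannianBundle (fun x : M => TangentSpace (𝓡 n) x)] [MeasurableSpace M] : Measure M :=
  ⨆ e ∈ atlas (EuclideanSpace ℝ (Fin n)) M, chartVolume n e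

/-- A random measure: a measurable map into the locally finite measures, where spaces of measures
carry the `σ`-algebra generated by the evaluations `μ ↦ μ B`. On the spaces considered
here, a locally finite Borel measure is the same as a Radon measure. -/
structure IsRandomMeasure {Ω X : Type*} [MeasurableSpace Ω] [TopologicalSpace X]
    [MeasurableSpace X] (lam : Ω → Measure X) : Prop where
  measurable : Measurable lam
  locallyFinite : ∀ ω, IsLocallyFiniteMeasure (lam ω)

/-- The random measure `lam` is equivariant: `lam (θ_g ω) (g B) = lam ω B`. -/
def IsEquivariant {G Ω M : Type*} [SMul G M] [MeasurableSpace M]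
    (θ : G → Ω → Ω) (lam : Ω → Measure M) : Prop :=
  ∀ (g : G) (ω : Ω) (B : Set M), MeasurableSet B → lam (θ g ω) (g • B) = lam ω B

/-- The Campbell measure `lam ω (dx) P(dω)` of a random measure. -/
def campbell {Ω X : Type*} [MeasurableSpace Ω] [MeasurableSpace X]
    (P : Measure Ω) (lam : Ω → Measure X) : Measure (X × Ω) :=
  P.bind fun ω => (lam ω).map fun x => (x, ω)

/-- `q` is a semicoupling of `lam` and `mu`: its first marginal is at most `lam`, its second
marginal is `mu`. (If `lam` is locally finite, then so is `q`.) -/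
structure IsSemicoupling {M : Type*} [MeasurableSpace M]
    (lam mu : Measure M) (q : Measure (M × M)) : Prop where
  fst_le : q.map Prod.fst ≤ lam
  snd_eq : q.map Prod.snd = mu

/-- `Q` is a semicoupling of the measures `Lam` and `Mu` on `M × Ω` that is concentrated on the
diagonal of `Ω × Ω`, and is therefore regarded as a measure on `M × M × Ω`. -/
structure IsDiagonalSemicoupling {Ω M : Type*} [MeasurableSpace Ω] [MeasurableSpace M]
    (Lam Mu : Measure (M × Ω)) (Q : Measure ((M × M) × Ω)) : Prop where
  fst_le : Q.map (fun p => (p.1.1, p.2)) ≤ Lam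
  snd_eq : Q.map (fun p => (p.1.2, p.2)) = Mu

/-- `q` is a coupling of `lam` and `mu`. -/
structure IsCoupling {M : Type*} [MeasurableSpace M]
    (lam mu : Measure M) (q : Measure (M × M)) : Prop where
  fst_eq : q.map Prod.fst = lam
  snd_eq : q.map Prod.snd = mu

/-- The cost `∫ ϑ(d(x,y)) q(dx,dy)`. -/
def transportCost {M : Type*} [PseudoMetricSpace M] [MeasurableSpace M]
    (ϑ : ℝ≥0 → ℝ≥0) (q : Measure (M × M)) : ℝ≥0∞ :=
  ∫⁻ p, (ϑ (nndist p.1 p.2) : ℝ≥0∞) ∂q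

/-- The mean cost `∫ ϑ(d(x,y)) Q(dx,dy,dω)`. -/
def meanCost {Ω M : Type*} [MeasurableSpace Ω] [PseudoMetricSpace M] [MeasurableSpace M]
    (ϑ : ℝ≥0 → ℝ≥0) (Q : Measure ((M × M) × Ω)) : ℝ≥0∞ :=
  ∫⁻ p, (ϑ (nndist p.1.1 p.1.2) : ℝ≥0∞) ∂Q

/-- `a` minimizes `f` on `S`. -/
def IsMinimizer {α : Type*} (S : Set α) (f : α → ℝ≥0∞) (a : α) : Prop :=
  a ∈ S ∧ ∀ b ∈ S, f a ≤ f b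

/-- `a` is the only minimizer of `f` on `S`. -/
def IsUniqueMinimizer {α : Type*} (S : Set α) (f : α → ℝ≥0∞) (a : α) : Prop :=
  IsMinimizer S f a ∧ ∀ b, IsMinimizer S f b → b = a

/-- A scale function: continuous, strictly increasing, `ϑ 0 = 0`, and `ϑ r → ∞`. -/
structure IsScaleFunction (ϑ : ℝ≥0 → ℝ≥0) : Prop where
  continuous : Continuous ϑ
  strictMono : StrictMono ϑ
  map_zero : ϑ 0 = 0
  tendsto : Tendsto ϑ atTop atTop

/-- The classical Monge problem is uniquely solvable: for any two compactly supported probability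
measures, the first one absolutely continuous with respect to `m`, there is a unique optimal
coupling, and it is induced by a measurable map. -/
def UniqueMongeSolutions {M : Type*} [PseudoMetricSpace M] [MeasurableSpace M]
    (m : Measure M) (ϑ : ℝ≥0 → ℝ≥0) : Prop :=
  ∀ lam mu : Measure M, IsProbabilityMeasure lam → IsProbabilityMeasure mu →
    (∃ K, IsCompact K ∧ lam Kᶜ = 0) → (∃ K, IsCompact K ∧ mu Kᶜ = 0) → lam ≪ m →
    ∃ T : M → M, Measurable T ∧
      IsUniqueMinimizer {q | IsCoupling lam mu q} (transportCost ϑ) (lam.map fun x => (x, T x))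

end

/-! The problem decouples over `ω`: it suffices to solve it for almost every realization, measurably
in `ω`, and to integrate.

Two geometric facts prepare this. Cocompactness makes all closed balls of one fixed radius compact,
and the length structure propagates this to all radii, so `M` is proper and `1_A μ` is finite with
compact support. By stationarity `λ` almost surely has infinite mass: averaging `λ / λ(M)` over `P`
gives a finite measure charging all translates of a ball equally, and translates escape to infinity,
so it vanishes. Hence almost every realization admits a semicoupling of finite cost, although the
mean cost may be infinite.

For fixed `ω`, a bounded piece of an optimal semicoupling is an optimal coupling of its own
marginals, so the optimum lives on a graph. Uniqueness (`eq_of_isMinimizer`) averages two optima.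
The average is again optimal, hence carried by the graph of one map `T`. Where the densities of the
two first marginals differ, the average does not exhaust `λ`; by `ae_eq_self_of_isMinimizer` it
moves nothing there. So the first marginals agree off the fixed points of `T`, and on the fixed
points they are determined by the common second marginal.

For measurable existence, cost and constraints are encoded as a supremum of countably many
functionals on probability measures, continuous and measurable in `ω`. Tightness and uniqueness make
near-minimizers taken from a dense sequence converge (`exists_measurable_tendsto_argmin`).

Finally, every competitor on `M × M × Ω` disintegrates into semicouplings for almost every `ω`, so
pointwise optimality integrates; equality of finite integrals forces pointwise equality of costs,
hence uniqueness. Joint measurability of density and map comes from Radon–Nikodym derivatives of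
Campbell measures. -/

/-! ### Countable test families and the weak topology -/

section TestFunctions

variable {X : Type*} [MetricSpace X] [SecondCountableTopology X] [MeasurableSpace X] [BorelSpace X]

/-- In a second countable metric space, the measures of open sets are determined by the integrals
of countably many bounded continuous functions. -/
theorem exists_countable_testFunctions (X : Type*) [MetricSpace X] [SecondCountableTopology X]
    [MeasurableSpace X] [BorelSpace X] :
    ∃ φ : ℕ → BoundedContinuousFunction X ℝ≥0, ∀ (U : Set X), IsOpen U →
      ∀ (μ : Measure X) (a : ℝ≥0∞), a < μ U →
        ∃ j, (∀ x, (φ j x : ℝ≥0∞) ≤ U.indicator 1 x) ∧ a < ∫⁻ x, φ j x ∂μ := by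
  set B := TopologicalSpace.countableBasis X
  have : Countable B := (TopologicalSpace.countable_countableBasis X).to_subtype
  -- Finite unions of basic sets inside `U` form a directed family, so one of them already has mass
  -- above `a`.
  let V : Finset B → Set X := fun s => ⋃ b ∈ s, (b : Set X)
  have hV : ∀ s, IsOpen (V s) := fun s => isOpen_biUnion fun b _ =>
    TopologicalSpace.isOpen_of_mem_countableBasis b.2
  choose f hf1 hf2 hf3 using fun s => HasOuterApproxClosed.exAppr _ (hV s).isClosed_compl
  obtain ⟨e, he⟩ := exists_surjective_nat (Finset B × ℕ)
  -- Subtraction is truncated: `f ≥ 1` off `V s` makes `1 - f` vanish there. Fatou's lemma below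
  -- then needs no finiteness of `μ`.
  refine ⟨fun j => 1 - f (e j).1 (e j).2, fun U hU μ a ha => ?_⟩
  obtain ⟨S, hS, hUS⟩ := (TopologicalSpace.isBasis_countableBasis X).open_eq_sUnion hU
  have hSc : S.Countable := (TopologicalSpace.countable_countableBasis X).mono hS
  let t : Set B := {b | (b : Set X) ⊆ U}
  have hUeq : U = ⋃ s : {s : Finset B // ∀ b ∈ s, b ∈ t}, V s := by
    apply subset_antisymm
    · intro x hx
      rw [hUS] at hx
      obtain ⟨b, hb, hxb⟩ := hx
      refine mem_iUnion.2 ⟨⟨{⟨b, hS hb⟩}, ?_⟩, ?_⟩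
      · simp only [Finset.mem_singleton, forall_eq, t, mem_ofPred_eq]
        rw [hUS]; exact subset_sUnion_of_mem hb
      · simpa [V] using ⟨hS hb, hxb⟩
    · exact iUnion_subset fun s => iUnion₂_subset fun b hb => s.2 b hb
  have hdir : Directed (· ⊆ ·) fun s : {s : Finset B // ∀ b ∈ s, b ∈ t} => V s := by
    classical
    intro s s'
    refine ⟨⟨s ∪ s', fun b hb => ?_⟩, ?_, ?_⟩
    · rcases Finset.mem_union.1 hb with h | h
      exacts [s.2 b h, s'.2 b h]
    · exact biUnion_subset_biUnion_left fun b hb => Finset.mem_union_left _ hb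
    · exact biUnion_subset_biUnion_left fun b hb => Finset.mem_union_right _ hb
  have ha' : a < μ U := ha
  rw [hUeq, hdir.measure_iUnion] at ha'
  obtain ⟨s, hs⟩ := lt_iSup_iff.1 ha'
  have hsU : V s ⊆ U := by
    rw [hUeq]
    exact subset_iUnion (fun s : {s : Finset B // ∀ b ∈ s, b ∈ t} => V s) s
  have key : μ (V s) ≤ liminf (fun n => ∫⁻ x, ((1 - f s n : BoundedContinuousFunction X ℝ≥0) x : ℝ≥0∞) ∂μ) atTop := by
    calc μ (V s) = ∫⁻ x, (V s).indicator 1 x ∂μ := by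
          rw [lintegral_indicator_one (hV s).measurableSet]
      _ ≤ ∫⁻ x, liminf (fun n => ((1 - f s n : BoundedContinuousFunction X ℝ≥0) x : ℝ≥0∞)) atTop ∂μ := by
          refine lintegral_mono fun x => ?_
          have h3 := tendsto_pi_nhds.1 (hf3 s) x
          have h4 : Tendsto (fun n => ((1 - f s n : BoundedContinuousFunction X ℝ≥0) x : ℝ≥0∞)) atTop
              (𝓝 ((1 - (V s)ᶜ.indicator (fun _ => (1 : ℝ≥0)) x : ℝ≥0) : ℝ≥0∞)) := by
            refine ENNReal.tendsto_coe.2 ?_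
            exact (tendsto_const_nhds.sub h3)
          rw [h4.liminf_eq]
          by_cases hx : x ∈ V s <;> simp [hx]
      _ ≤ _ := lintegral_liminf_le fun n => by
          exact ((1 - f s n : BoundedContinuousFunction X ℝ≥0).continuous.measurable).coe_nnreal_ennreal
  obtain ⟨n, hn⟩ := (eventually_lt_of_lt_liminf (hs.trans_le key)).exists
  obtain ⟨j, hj⟩ := he (s, n)
  refine ⟨j, fun x => ?_, ?_⟩
  · simp only [hj]
    by_cases hx : x ∈ U
    · simp [hx]
    · have h1 : x ∈ (V s)ᶜ := fun h => hx (hsU h)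
      simp only [hx, not_false_eq_true, indicator_of_notMem]
      have := hf2 s n x h1
      have : (1 - f s n : BoundedContinuousFunction X ℝ≥0) x = 0 := by
        show 1 - f s n x = 0
        exact tsub_eq_zero_of_le this
      simp [this]
  · simpa only [hj] using hn

/-- A countable family of test functions as in `exists_countable_testFunctions`. -/
noncomputable def testFunction (X : Type*) [MetricSpace X] [SecondCountableTopology X]
    [MeasurableSpace X] [BorelSpace X] : ℕ → BoundedContinuousFunction X ℝ≥0 :=
  (exists_countable_testFunctions X).choose

theorem exists_testFunction_lt_lintegral {U : Set X} (hU : IsOpen U) {μ : Measure X} {a : ℝ≥0∞}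
    (ha : a < μ U) : ∃ j, (∀ x, (testFunction X j x : ℝ≥0∞) ≤ U.indicator 1 x) ∧
      a < ∫⁻ x, testFunction X j x ∂μ :=
  (exists_countable_testFunctions X).choose_spec U hU μ a ha

theorem measurable_testFunction (j : ℕ) : Measurable fun x => (testFunction X j x : ℝ≥0∞) :=
  (testFunction X j).continuous.measurable.coe_nnreal_ennreal

theorem lintegral_testFunction_le {U : Set X} (hU : IsOpen U) {j : ℕ}
    (hj : ∀ x, (testFunction X j x : ℝ≥0∞) ≤ U.indicator 1 x) (μ : Measure X) :
    ∫⁻ x, testFunction X j x ∂μ ≤ μ U := by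
  rw [← lintegral_indicator_one hU.measurableSet]
  exact lintegral_mono hj

/-- Masses of open sets are suprema of test integrals, which gives the inequality on open sets;
outer regularity is needed only for the larger measure. -/
theorem measure_le_of_testFunction {a b : Measure X} [b.OuterRegular]
    (h : ∀ j, ∫⁻ x, testFunction X j x ∂a ≤ ∫⁻ x, testFunction X j x ∂b) : a ≤ b := by
  have hopen : ∀ U, IsOpen U → a U ≤ b U := fun U hU => by
    refine le_of_forall_lt fun c hc => ?_
    obtain ⟨j, hj1, hj2⟩ := exists_testFunction_lt_lintegral hU hc
    exact hj2.trans_le ((h j).trans (lintegral_testFunction_le hU hj1 b))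
  refine Measure.le_iff.2 fun s _ => ?_
  refine le_of_forall_gt fun c hc => ?_
  obtain ⟨U, hsU, hU, hUc⟩ := s.exists_isOpen_lt_of_lt c hc
  exact ((measure_mono hsU).trans (hopen U hU)).trans_lt hUc

/-- The test integrals induce the weak topology: their convergence bounds the lower limits of masses
of open sets, which is the portmanteau criterion. -/
instance secondCountableTopology_probabilityMeasure :
    SecondCountableTopology (ProbabilityMeasure X) := by
  let Φ : ProbabilityMeasure X → ℕ → ℝ≥0∞ := fun μ j => ∫⁻ x, testFunction X j x ∂(μ : Measure X)
  have hΦ : Continuous Φ := continuous_pi fun j =>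
    ProbabilityMeasure.continuous_lintegral_boundedContinuousFunction _
  suffices h : IsInducing Φ from h.secondCountableTopology
  refine isInducing_iff_nhds.2 fun μ => le_antisymm (hΦ.tendsto μ).le_comap ?_
  have key : Tendsto (fun ν : ProbabilityMeasure X => ν) (comap Φ (𝓝 (Φ μ))) (𝓝 μ) := by
    refine tendsto_of_forall_isOpen_le_liminf' fun U hU => ?_
    rw [le_liminf_iff]
    intro a ha
    obtain ⟨j, hj1, hj2⟩ := exists_testFunction_lt_lintegral hU ha
    have h1 : Tendsto (fun ν : ProbabilityMeasure X => Φ ν j) (comap Φ (𝓝 (Φ μ))) (𝓝 (Φ μ j)) :=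
      (((continuous_apply j).tendsto (Φ μ)).comp tendsto_comap :)
    filter_upwards [h1.eventually (lt_mem_nhds hj2)] with ν hν
    exact hν.trans_le (lintegral_testFunction_le hU hj1 _)
  exact key

/-- Measurability of a limit of measurable families of probability measures. -/
theorem measurable_of_tendsto_probabilityMeasure {Ω : Type*} [MeasurableSpace Ω]
    {x : ℕ → Ω → ProbabilityMeasure X} {e : Ω → ProbabilityMeasure X}
    (hx : ∀ N j, Measurable fun ω => ∫⁻ p, testFunction X j p ∂(x N ω : Measure X))
    (hlim : ∀ ω, Tendsto (fun N => x N ω) atTop (𝓝 (e ω))) :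
    Measurable fun ω => (e ω : Measure X) := by
  have h1 : ∀ j, Measurable fun ω => ∫⁻ p, testFunction X j p ∂(e ω : Measure X) := fun j =>
    measurable_of_tendsto_metrizable (fun N => hx N j) (tendsto_pi_nhds.2 fun ω =>
      ((ProbabilityMeasure.continuous_lintegral_boundedContinuousFunction
        (testFunction X j)).tendsto _).comp (hlim ω))
  refine Measurable.measure_of_isPiSystem_of_isProbabilityMeasure
    (S := {U : Set X | IsOpen U}) BorelSpace.measurable_eq
    isPiSystem_isOpen fun U hU => ?_
  -- The mass of an open set is a countable supremum of test integrals, and open sets form a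
  -- generating π-system.
  have h2 : (fun ω => (e ω : Measure X) U) = fun ω =>
      ⨆ j : {j : ℕ // ∀ x, (testFunction X j x : ℝ≥0∞) ≤ U.indicator 1 x},
        ∫⁻ p, testFunction X j p ∂(e ω : Measure X) := by
    funext ω
    refine le_antisymm (le_of_forall_lt fun a ha => ?_) (iSup_le fun j =>
      lintegral_testFunction_le hU j.2 _)
    obtain ⟨j, hj1, hj2⟩ := exists_testFunction_lt_lintegral hU ha
    exact hj2.trans_le (le_iSup (fun j : {j : ℕ // ∀ x, (testFunction X j x : ℝ≥0∞) ≤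
      U.indicator 1 x} => ∫⁻ p, testFunction X j p ∂(e ω : Measure X)) ⟨j, hj1⟩)
  rw [h2]
  exact Measurable.iSup fun j => h1 j

end TestFunctions

/-! ### Measurable selection of minimizers -/

/-- **Measurable selection of a unique minimizer.** The supremum of countably many continuous
functionals that depend measurably on a parameter and are jointly coercive has a minimizer; where it
is unique, it is the limit of measurable choices from a fixed sequence. -/
theorem exists_measurable_tendsto_argmin {Ω E : Type*} [MeasurableSpace Ω] [TopologicalSpace E]
    [SecondCountableTopology E] [Nonempty E] (g : ℕ → Ω → E → ℝ≥0∞)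
    (hcont : ∀ i ω, Continuous (g i ω)) (hmeas : ∀ i e, Measurable fun ω => g i ω e) :
    ∃ (d : ℕ → E) (k : ℕ → Ω → ℕ), (∀ N, Measurable (k N)) ∧ ∀ ω,
      (∃ e, ⨆ i, g i ω e < ∞) →
      (∀ a < ∞, ∀ u : ℕ → E, (∀ i, ∀ᶠ N in atTop, g i ω (u N) ≤ a) →
        ∃ e, ∃ ψ : ℕ → ℕ, StrictMono ψ ∧ Tendsto (u ∘ ψ) atTop (𝓝 e)) →
      (∀ e e', (∀ b, ⨆ i, g i ω e ≤ ⨆ i, g i ω b) → (∀ b, ⨆ i, g i ω e' ≤ ⨆ i, g i ω b) → e = e') →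
      ∃ e, (∀ b, ⨆ i, g i ω e ≤ ⨆ i, g i ω b) ∧ Tendsto (fun N => d (k N ω)) atTop (𝓝 e) := by
  classical
  let d := TopologicalSpace.denseSeq E
  -- Finite maxima stay continuous, unlike the full supremum, so their infimum over `E` is attained
  -- along the dense sequence and is measurable in `ω`.
  let h : ℕ → Ω → E → ℝ≥0∞ := fun N ω e => (Finset.range (N + 1)).sup fun i => g i ω e
  have hh_cont : ∀ N ω, Continuous (h N ω) := fun N ω =>
    Continuous.finset_sup_apply fun i _ => hcont i ω
  have hh_meas : ∀ N e, Measurable fun ω => h N ω e := fun N e => by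
    have : (fun ω => h N ω e) = (Finset.range (N + 1)).sup fun i ω => g i ω e := by
      funext ω; simp [h, Finset.sup_apply]
    rw [this]
    exact Finset.sup_induction measurable_const (fun _ hf _ hf' => hf.sup hf') fun i _ => hmeas i e
  let v : ℕ → Ω → ℝ≥0∞ := fun N ω => ⨅ k, h N ω (d k)
  have hv_meas : ∀ N, Measurable (v N) := fun N => Measurable.iInf fun k => hh_meas N (d k)
  have hv_le : ∀ N ω e, v N ω ≤ h N ω e := fun N ω e => by
    have hcl : IsClosed {e | v N ω ≤ h N ω e} := isClosed_le continuous_const (hh_cont N ω)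
    have hsub : range d ⊆ {e | v N ω ≤ h N ω e} := by
      rintro _ ⟨k, rfl⟩
      exact iInf_le (fun k => h N ω (d k)) k
    exact hcl.closure_subset_iff.2 hsub (TopologicalSpace.denseRange_denseSeq E e)
  let p : ℕ → Ω → ℕ → Prop := fun N ω k => h N ω (d k) ≤ v N ω + ((N : ℝ≥0∞) + 1)⁻¹
  have hp : ∀ N ω, ∃ k, p N ω k := fun N ω => by
    by_cases hv : v N ω = ∞
    · exact ⟨0, by simp [p, hv]⟩
    · have : v N ω < v N ω + ((N : ℝ≥0∞) + 1)⁻¹ :=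
        ENNReal.lt_add_right hv (by simp)
      obtain ⟨k, hk⟩ := iInf_lt_iff.1 this
      exact ⟨k, hk.le⟩
  refine ⟨d, fun N ω => Nat.find (hp N ω), fun N => measurable_find _ fun k =>
    measurableSet_le (hh_meas N _) ((hv_meas N).add_const _), fun ω hfin hcomp huniq => ?_⟩
  set x : ℕ → E := fun N => d (Nat.find (hp N ω))
  have hx : ∀ N, h N ω (x N) ≤ v N ω + ((N : ℝ≥0∞) + 1)⁻¹ := fun N => Nat.find_spec (hp N ω)
  set V : ℝ≥0∞ := ⨅ e, ⨆ i, g i ω e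
  have hV : V < ∞ := by
    obtain ⟨e, he⟩ := hfin
    exact (iInf_le _ e).trans_lt he
  have hvV : ∀ N, v N ω ≤ V := fun N => le_iInf fun e => (hv_le N ω e).trans
    (Finset.sup_le fun i _ => le_iSup (fun i => g i ω e) i)
  have hgx : ∀ i N, i ≤ N → g i ω (x N) ≤ V + ((N : ℝ≥0∞) + 1)⁻¹ := fun i N hiN =>
    (Finset.le_sup (f := fun i => g i ω (x N)) (Finset.mem_range.2 (Nat.lt_succ_of_le hiN))).trans
      ((hx N).trans (by gcongr; exact hvV N))
  have htend : Tendsto (fun N : ℕ => V + ((N : ℝ≥0∞) + 1)⁻¹) atTop (𝓝 V) := by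
    have h1 : Tendsto (fun N : ℕ => ((N : ℝ≥0∞) + 1)⁻¹) atTop (𝓝 0) := by
      have := (tendsto_add_atTop_iff_nat 1).2 ENNReal.tendsto_inv_nat_nhds_zero
      simpa using this
    simpa using tendsto_const_nhds.add h1
  -- Each single `g i` is eventually at most `V + 1/(N+1)` along the sequence, so continuity bounds
  -- it by `V` at any limit point.
  have hlim : ∀ (φ : ℕ → ℕ), Tendsto φ atTop atTop → ∀ e, Tendsto (x ∘ φ) atTop (𝓝 e) →
      ∀ b, ⨆ i, g i ω e ≤ ⨆ i, g i ω b := by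
    intro φ hφ e he b
    refine (iSup_le fun i => ?_).trans (iInf_le _ b : V ≤ _)
    refine le_of_tendsto_of_tendsto (((hcont i ω).tendsto e).comp he) (htend.comp hφ) ?_
    filter_upwards [hφ.eventually_ge_atTop i] with N hN
    exact hgx i _ hN
  have hsub : ∀ (φ : ℕ → ℕ), Tendsto φ atTop atTop →
      ∃ e, ∃ ψ : ℕ → ℕ, StrictMono ψ ∧ Tendsto (x ∘ φ ∘ ψ) atTop (𝓝 e) := by
    intro φ hφ
    refine hcomp (V + 1) (by simp [hV]) (x ∘ φ) fun i => ?_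
    filter_upwards [hφ.eventually_ge_atTop i] with N hN
    refine (hgx i _ hN).trans ?_
    gcongr
    simp
  obtain ⟨e, ψ, hψ, he⟩ := hsub id tendsto_id
  have hemin := hlim ψ hψ.tendsto_atTop e he
  refine ⟨e, hemin, ?_⟩
  refine tendsto_of_subseq_tendsto fun ns hns => ?_
  obtain ⟨e', ψ', hψ', he'⟩ := hsub ns hns
  have := huniq e e' hemin (hlim (ns ∘ ψ') (hns.comp hψ'.tendsto_atTop) e' he')
  exact ⟨ψ', this ▸ he'⟩

/-! ### Push-forwards, densities and graphs -/

section MeasureLemmas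

variable {X Y : Type*} [MeasurableSpace X] [MeasurableSpace Y]

theorem map_withDensity_comp {f : X → Y} (hf : Measurable f) (μ : Measure X) {h : Y → ℝ≥0∞}
    (hh : Measurable h) : (μ.withDensity (h ∘ f)).map f = (μ.map f).withDensity h := by
  ext s hs
  rw [Measure.map_apply hf hs, withDensity_apply _ (hf hs), withDensity_apply _ hs,
    setLIntegral_map hs hh hf]
  rfl

/-- The density of `τ` with respect to the image is pulled back along `f`. This cuts out of a plan a
part with prescribed second marginal. -/
theorem exists_le_map_eq {f : X → Y} (hf : Measurable f) (μ : Measure X) [IsFiniteMeasure μ]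
    {τ : Measure Y} (hτ : τ ≤ μ.map f) : ∃ κ ≤ μ, κ.map f = τ := by
  have : IsFiniteMeasure τ := isFiniteMeasure_of_le _ hτ
  refine ⟨μ.withDensity (τ.rnDeriv (μ.map f) ∘ f), ?_, ?_⟩
  · have h1 : ∀ᵐ y ∂(μ.map f), τ.rnDeriv (μ.map f) y ≤ 1 := Measure.rnDeriv_le_one_of_le hτ
    conv_rhs => rw [← withDensity_one (μ := μ)]
    exact withDensity_mono (ae_of_ae_map hf.aemeasurable h1)
  · rw [map_withDensity_comp hf _ (Measure.measurable_rnDeriv _ _),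
      Measure.withDensity_rnDeriv_eq _ _ (Measure.absolutelyContinuous_of_le hτ)]

theorem add_left_cancel_of_isFiniteMeasure {a b c : Measure X} [IsFiniteMeasure a]
    (h : a + b = a + c) : b = c := by
  ext s hs
  have := congrArg (fun μ : Measure X => μ s) h
  simp only [Measure.add_apply] at this
  exact (ENNReal.add_right_inj (measure_ne_top a s)).1 this

theorem eq_map_graph {q : Measure (X × Y)} {T : X → Y} (hT : Measurable T)
    (h : ∀ᵐ p ∂q, p.2 = T p.1) : q = (q.map Prod.fst).map fun x => (x, T x) := by
  rw [Measure.map_map (by fun_prop) measurable_fst]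
  conv_lhs => rw [← Measure.map_id (μ := q)]
  refine Measure.map_congr ?_
  filter_upwards [h] with p hp
  exact Prod.ext rfl hp

theorem map_fst_map_graph {a : Measure X} {T : X → Y} (hT : Measurable T) :
    (a.map fun x => (x, T x)).map Prod.fst = a := by
  rw [Measure.map_map measurable_fst (by fun_prop)]
  exact Measure.map_id

theorem map_snd_map_graph {a : Measure X} {T : X → Y} (hT : Measurable T) :
    (a.map fun x => (x, T x)).map Prod.snd = a.map T := by
  rw [Measure.map_map measurable_snd (by fun_prop)]
  rfl

theorem map_snd_eq_of_ae_graph {q : Measure (X × Y)} {T : X → Y} (hT : Measurable T)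
    (h : ∀ᵐ p ∂q, p.2 = T p.1) : q.map Prod.snd = (q.map Prod.fst).map T := by
  conv_lhs => rw [eq_map_graph hT h, map_snd_map_graph hT]

end MeasureLemmas

/-! ### Structure of optimal semicouplings -/

section Semicouplings

variable {M : Type*} [MetricSpace M] [ProperSpace M] [MeasurableSpace M] [BorelSpace M]
  {m lam nu : Measure M} {ϑ : ℝ≥0 → ℝ≥0} {q : Measure (M × M)}

theorem measurable_cost (hϑ : Continuous ϑ) :
    Measurable fun p : M × M => (ϑ (nndist p.1 p.2) : ℝ≥0∞) :=
  (hϑ.comp continuous_nndist).measurable.coe_nnreal_ennreal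

omit [ProperSpace M] [BorelSpace M] in
theorem transportCost_add (q r : Measure (M × M)) :
    transportCost ϑ (q + r) = transportCost ϑ q + transportCost ϑ r :=
  lintegral_add_measure _ _ _

omit [ProperSpace M] [BorelSpace M] in
theorem transportCost_smul (c : ℝ≥0∞) (q : Measure (M × M)) :
    transportCost ϑ (c • q) = c * transportCost ϑ q := by
  simp [transportCost, lintegral_smul_measure]

omit [ProperSpace M] [BorelSpace M] in
theorem transportCost_mono {q r : Measure (M × M)} (h : q ≤ r) :
    transportCost ϑ q ≤ transportCost ϑ r :=
  lintegral_mono' h le_rfl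

omit [MetricSpace M] [ProperSpace M] [BorelSpace M] in
theorem IsCoupling.smul {a b : Measure M} {r : Measure (M × M)} (h : IsCoupling a b r) (c : ℝ≥0∞) :
    IsCoupling (c • a) (c • b) (c • r) :=
  ⟨by rw [Measure.map_smul, h.fst_eq], by rw [Measure.map_smul, h.snd_eq]⟩

/-- Unique solvability of the Monge problem for probability measures yields that optimal couplings
of finite measures are concentrated on graphs. -/
theorem UniqueMongeSolutions.exists_graph (hMonge : UniqueMongeSolutions m ϑ) {a b : Measure M}
    [IsFiniteMeasure a] (hK : ∃ K, IsCompact K ∧ a Kᶜ = 0) (hL : ∃ L, IsCompact L ∧ b Lᶜ = 0)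
    (ha : a ≪ m) {pl : Measure (M × M)}
    (hpl : IsMinimizer {q | IsCoupling a b q} (transportCost ϑ) pl) :
    ∃ T : M → M, Measurable T ∧ ∀ᵐ p ∂pl, p.2 = T p.1 := by
  have hpla : pl univ = a univ := by
    rw [← hpl.1.fst_eq, Measure.map_apply measurable_fst MeasurableSet.univ, preimage_univ]
  have hba : b univ = a univ := by
    rw [← hpla, ← hpl.1.snd_eq, Measure.map_apply measurable_snd MeasurableSet.univ, preimage_univ]
  by_cases h0 : a univ = 0
  · rw [h0] at hpla
    rw [Measure.measure_univ_eq_zero.1 hpla]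
    exact ⟨id, measurable_id, by simp⟩
  have htop : a univ ≠ ∞ := measure_ne_top _ _
  set t := (a univ)⁻¹
  have ht0 : t ≠ 0 := ENNReal.inv_ne_zero.2 htop
  obtain ⟨K, hK, hKa⟩ := hK
  obtain ⟨L, hL, hLb⟩ := hL
  obtain ⟨T, hT, hmin, huniq⟩ := hMonge (t • a) (t • b)
    ⟨by simp [t, ENNReal.inv_mul_cancel h0 htop]⟩
    ⟨by simp [t, hba, ENNReal.inv_mul_cancel h0 htop]⟩
    ⟨K, hK, by simp [hKa]⟩ ⟨L, hL, by simp [hLb]⟩ (ha.smul_left t)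
  have h1 : IsMinimizer {q | IsCoupling (t • a) (t • b) q} (transportCost ϑ) (t • pl) := by
    refine ⟨hpl.1.smul t, fun r hr => ?_⟩
    have h2 := hpl.2 (a univ • r) (by
      have := IsCoupling.smul hr (a univ)
      rwa [smul_smul, smul_smul, ENNReal.mul_inv_cancel h0 htop, one_smul, one_smul] at this)
    rw [transportCost_smul] at h2 ⊢
    calc t * transportCost ϑ pl ≤ t * (a univ * transportCost ϑ r) := by gcongr
      _ = transportCost ϑ r := by
        rw [← mul_assoc, ENNReal.inv_mul_cancel h0 htop, one_mul]
  refine ⟨T, hT, ?_⟩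
  have h3 : ∀ᵐ p ∂(t • pl), p.2 = T p.1 := by
    rw [huniq _ h1]
    refine (ae_map_iff (by fun_prop) (measurableSet_eq_fun measurable_snd
      (hT.comp measurable_fst))).2 (by simp)
  rwa [Measure.ae_ennreal_smul_measure_iff ht0] at h3

omit [ProperSpace M] [BorelSpace M] in
/-- Replacing a part of an optimal semicoupling does not decrease the cost. -/
theorem transportCost_le_of_replace
    (hq : IsMinimizer {r | IsSemicoupling lam nu r} (transportCost ϑ) q)
    (hfin : transportCost ϑ q < ∞) {q' q'' κ : Measure (M × M)} (hsum : q = q' + q'')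
    (hsnd : κ.map Prod.snd = q'.map Prod.snd)
    (hfst : κ.map Prod.fst + q''.map Prod.fst ≤ lam) :
    transportCost ϑ q' ≤ transportCost ϑ κ := by
  have h1 : IsSemicoupling lam nu (κ + q'') := by
    refine ⟨by rwa [Measure.map_add _ _ measurable_fst], ?_⟩
    rw [Measure.map_add _ _ measurable_snd, hsnd, ← Measure.map_add _ _ measurable_snd, ← hsum,
      hq.1.snd_eq]
  have h2 := hq.2 _ h1
  rw [hsum, transportCost_add, transportCost_add] at h2
  have h3 : transportCost ϑ q'' ≠ ∞ :=
    ((transportCost_mono (hsum ▸ Measure.le_add_left le_rfl)).trans_lt hfin).ne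
  exact (ENNReal.add_le_add_iff_right h3).1 h2

omit [MetricSpace M] [ProperSpace M] [BorelSpace M] in
theorem IsSemicoupling.isFiniteMeasure [IsFiniteMeasure nu] (hq : IsSemicoupling lam nu q) :
    IsFiniteMeasure q := by
  refine ⟨?_⟩
  have : q univ = nu univ := by
    rw [← hq.snd_eq, Measure.map_apply measurable_snd MeasurableSet.univ, preimage_univ]
  rw [this]
  exact measure_lt_top _ _

/-- An optimal semicoupling is concentrated on a graph. -/
theorem exists_graph_of_isMinimizer [Nonempty M] [IsLocallyFiniteMeasure lam] (hac : lam ≪ m)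
    (hMonge : UniqueMongeSolutions m ϑ) [IsFiniteMeasure nu] (hnu : ∃ L, IsCompact L ∧ nu Lᶜ = 0)
    (hq : IsMinimizer {r | IsSemicoupling lam nu r} (transportCost ϑ) q)
    (hfin : transportCost ϑ q < ∞) :
    ∃ T : M → M, Measurable T ∧ ∀ᵐ p ∂q, p.2 = T p.1 := by
  have : IsFiniteMeasure q := hq.1.isFiniteMeasure
  obtain ⟨x0⟩ := ‹Nonempty M›
  -- The first marginal need not have compact support; cutting it into bounded shells makes the
  -- Monge hypothesis applicable, and the maps are glued along `N`.
  let N : M → ℕ := fun x => ⌊dist x x0⌋₊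
  have hN : Measurable N := (measurable_id.dist measurable_const).nat_floor
  let D : ℕ → Set M := fun n => N ⁻¹' {n}
  have hD : ∀ n, MeasurableSet (D n) := fun n => hN (measurableSet_singleton n)
  have hD' : ∀ n, MeasurableSet (Prod.fst ⁻¹' D n : Set (M × M)) := fun n => measurable_fst (hD n)
  have key : ∀ n, ∃ T : M → M, Measurable T ∧
      ∀ᵐ p ∂(q.restrict (Prod.fst ⁻¹' D n)), p.2 = T p.1 := by
    intro n
    set q' := q.restrict (Prod.fst ⁻¹' D n)
    have hsum : q = q' + q.restrict (Prod.fst ⁻¹' D n)ᶜ := (Measure.restrict_add_restrict_compl (hD' n)).symm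
    have hq'le : q' ≤ q := Measure.restrict_le_self
    refine hMonge.exists_graph (a := q'.map Prod.fst) (b := q'.map Prod.snd)
      ⟨Metric.closedBall x0 (n + 1), isCompact_closedBall _ _, ?_⟩ ?_ ?_ ⟨⟨rfl, rfl⟩, ?_⟩
    · rw [Measure.map_apply measurable_fst measurableSet_closedBall.compl,
        Measure.restrict_apply (measurable_fst measurableSet_closedBall.compl)]
      convert measure_empty (μ := q)
      ext p
      simp only [mem_inter_iff, mem_preimage, mem_compl_iff, Metric.mem_closedBall, not_le,
        mem_empty_iff_false, iff_false, not_and, D, mem_singleton_iff, N]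
      intro h1 h2
      have := Nat.lt_floor_add_one (dist p.1 x0)
      rw [h2] at this
      linarith
    · obtain ⟨L, hL, hL0⟩ := hnu
      refine ⟨L, hL, le_antisymm ?_ zero_le⟩
      rw [← hL0, ← hq.1.snd_eq]
      exact Measure.map_mono hq'le measurable_snd _
    · exact (Measure.absolutelyContinuous_of_le
        ((Measure.map_mono hq'le measurable_fst).trans hq.1.fst_le)).trans hac
    -- Any coupling of the marginals of the piece can replace it without changing either marginal of
    -- `q`, so the piece is optimal.
    · intro κ hκ
      refine transportCost_le_of_replace hq hfin hsum hκ.snd_eq ?_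
      rw [hκ.fst_eq, ← Measure.map_add _ _ measurable_fst, ← hsum]
      exact hq.1.fst_le
  choose T hT hgraph using key
  refine ⟨fun x => T (N x) x, ?_, ?_⟩
  · have : Measurable fun p : ℕ × M => T p.1 p.2 := measurable_from_prod_countable_right hT
    exact this.comp (hN.prodMk measurable_id)
  · have : ∀ᵐ p ∂q, ∀ n, p ∈ (Prod.fst ⁻¹' D n : Set (M × M)) → p.2 = T n p.1 :=
      ae_all_iff.2 fun n => (ae_restrict_iff' (hD' n)).1 (hgraph n)
    filter_upwards [this] with p hp
    exact hp _ rfl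

/-- Where there is room for more mass, an optimal semicoupling does not move mass. -/
theorem ae_eq_self_of_isMinimizer [Nonempty M] [IsLocallyFiniteMeasure lam] (hac : lam ≪ m)
    (hϑ : IsScaleFunction ϑ)
    (hMonge : UniqueMongeSolutions m ϑ) [IsFiniteMeasure nu] (hnu : ∃ L, IsCompact L ∧ nu Lᶜ = 0)
    (hq : IsMinimizer {r | IsSemicoupling lam nu r} (transportCost ϑ) q)
    (hfin : transportCost ϑ q < ∞) {T : M → M} (hT : Measurable T) (hgraph : ∀ᵐ p ∂q, p.2 = T p.1)
    {γ : Measure M} (hγ : γ ≤ q.map Prod.fst) (hγlam : q.map Prod.fst + γ ≤ lam) :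
    ∀ᵐ x ∂γ, T x = x := by
  have : IsFiniteMeasure q := hq.1.isFiniteMeasure
  wlog hK : ∃ K, IsCompact K ∧ γ Kᶜ = 0 generalizing γ
  · obtain ⟨x0⟩ := ‹Nonempty M›
    have h1 : ∀ n : ℕ, ∀ᵐ x ∂γ, x ∈ Metric.closedBall x0 n → T x = x := fun n => by
      rw [← ae_restrict_iff' measurableSet_closedBall]
      have hle : γ.restrict (Metric.closedBall x0 n) ≤ γ := Measure.restrict_le_self
      refine this (hle.trans hγ) ((add_le_add_right hle _).trans hγlam)
        ⟨Metric.closedBall x0 n, isCompact_closedBall _ _, ?_⟩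
      rw [Measure.restrict_apply measurableSet_closedBall.compl]
      simp
    filter_upwards [ae_all_iff.2 h1] with x hx
    obtain ⟨n, hn⟩ := exists_nat_ge (dist x x0)
    exact hx n hn
  obtain ⟨K, hK, hγK⟩ := hK
  obtain ⟨L, hL, hL0⟩ := hnu
  have : IsFiniteMeasure γ := isFiniteMeasure_of_le _ hγ
  set α := q.map Prod.fst
  set τ := γ.map T
  have hτnu : τ ≤ nu := by
    rw [← hq.1.snd_eq, map_snd_eq_of_ae_graph hT hgraph]
    exact Measure.map_mono hγ hT
  -- One copy of `γ` stays put and one follows `T`. Once this plan is known to be optimal it lies on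
  -- a single graph, which forces `T x = x`.
  set pl := γ.map (fun x => (x, x)) + γ.map (fun x => (x, T x))
  have hgm : Measurable fun x => (x, T x) := by fun_prop
  have hgm' : Measurable fun x : M => (x, x) := by fun_prop
  have hpl : IsCoupling (γ + γ) (γ + τ) pl := by
    constructor
    · rw [Measure.map_add _ _ measurable_fst, map_fst_map_graph hT, map_fst_map_graph measurable_id']
    · rw [Measure.map_add _ _ measurable_snd, map_snd_map_graph hT, map_snd_map_graph measurable_id',
        Measure.map_id']
  have hcost_pl : transportCost ϑ pl = transportCost ϑ (γ.map fun x => (x, T x)) := by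
    rw [transportCost_add, transportCost, lintegral_map (measurable_cost hϑ.continuous) hgm']
    simp [hϑ.map_zero]
  have hmin : IsMinimizer {r | IsCoupling (γ + γ) (γ + τ) r} (transportCost ϑ) pl := by
    refine ⟨hpl, fun pl' hpl' => ?_⟩
    have : IsFiniteMeasure pl' := by
      have : IsFiniteMeasure (pl'.map Prod.fst) := by rw [hpl'.fst_eq]; infer_instance
      exact Measure.isFiniteMeasure_of_map measurable_fst.aemeasurable
    -- The part `κ` of the competitor that serves `τ` uses at most `2γ`. The spare room in `lam`
    -- allows it to replace the transport of `γ` in `q`, so it costs at least as much; the resting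
    -- copy in `pl` is free.
    obtain ⟨κ, hκ, hκτ⟩ := exists_le_map_eq measurable_snd pl' (τ := τ)
      (by rw [hpl'.snd_eq]; exact Measure.le_add_left le_rfl)
    rw [hcost_pl]
    refine le_trans ?_ (transportCost_mono hκ)
    have hα : γ + (α - γ) = α := by rw [add_comm]; exact Measure.sub_add_cancel_of_le hγ
    refine transportCost_le_of_replace hq hfin (q'' := (α - γ).map fun x => (x, T x)) ?_ ?_ ?_
    · rw [← Measure.map_add _ _ hgm, hα]
      exact eq_map_graph hT hgraph
    · rw [hκτ, map_snd_map_graph hT]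
    · rw [map_fst_map_graph hT]
      calc κ.map Prod.fst + (α - γ) ≤ (γ + γ) + (α - γ) := by
            gcongr
            rw [← hpl'.fst_eq]
            exact Measure.map_mono hκ measurable_fst
        _ = α + γ := by rw [add_assoc, hα, add_comm]
        _ ≤ lam := hγlam
  have hsupp : (γ + τ) (K ∪ L)ᶜ = 0 := by
    rw [Measure.add_apply, add_eq_zero]
    constructor
    · exact measure_mono_null (compl_subset_compl.2 subset_union_left) hγK
    · refine measure_mono_null (compl_subset_compl.2 subset_union_right) ?_
      exact le_antisymm ((hτnu _).trans hL0.le) zero_le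
  have hγm : γ ≪ m := (Measure.absolutelyContinuous_of_le (hγ.trans hq.1.fst_le)).trans hac
  obtain ⟨S, hS, hSgraph⟩ := hMonge.exists_graph ⟨K, hK, by simp [hγK]⟩
    ⟨K ∪ L, hK.union hL, hsupp⟩ (Measure.AbsolutelyContinuous.add_left_iff.2 ⟨hγm, hγm⟩) hmin
  rw [ae_add_measure_iff] at hSgraph
  have h1 := ae_of_ae_map hgm'.aemeasurable hSgraph.1
  have h2 := ae_of_ae_map hgm.aemeasurable hSgraph.2
  filter_upwards [h1, h2] with x hx1 hx2
  exact hx2.trans hx1.symm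

end Semicouplings

/-! ### Uniqueness, and existence of finite cost -/

section UniqueSemicoupling

variable {M : Type*} [MetricSpace M] [ProperSpace M] [MeasurableSpace M] [BorelSpace M]
  {m lam nu : Measure M} {ϑ : ℝ≥0 → ℝ≥0} {q : Measure (M × M)}

/-- With truncated subtraction, `a + (a - b) + b = a + max a b`. For densities `a`, `b` of two first
marginals, their average leaves room for half the excess of `a` over `b`. -/
theorem half_add_half_tsub_le_one {a b : ℝ≥0∞} (ha : a ≤ 1) (hb : b ≤ 1) :
    2⁻¹ * (a + b) + 2⁻¹ * (a - b) ≤ 1 := by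
  rw [← mul_add, add_assoc, add_comm b, ← add_assoc]
  have h : a + (a - b) + b ≤ 2 := by
    rw [add_assoc, tsub_add_eq_max, ← one_add_one_eq_two]
    exact add_le_add ha (max_le ha hb)
  calc 2⁻¹ * (a + (a - b) + b) ≤ 2⁻¹ * 2 := by gcongr
    _ = 1 := ENNReal.inv_mul_cancel (by simp) (by simp)

/-- Optimal semicouplings of finite cost are unique. -/
theorem eq_of_isMinimizer [Nonempty M] [IsLocallyFiniteMeasure lam] (hac : lam ≪ m)
    (hϑ : IsScaleFunction ϑ)
    (hMonge : UniqueMongeSolutions m ϑ) [IsFiniteMeasure nu] (hnu : ∃ L, IsCompact L ∧ nu Lᶜ = 0)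
    {q₁ q₂ : Measure (M × M)}
    (hq₁ : IsMinimizer {r | IsSemicoupling lam nu r} (transportCost ϑ) q₁)
    (hq₂ : IsMinimizer {r | IsSemicoupling lam nu r} (transportCost ϑ) q₂)
    (hfin : transportCost ϑ q₁ < ∞) : q₁ = q₂ := by
  have hcost : transportCost ϑ q₂ = transportCost ϑ q₁ :=
    le_antisymm (hq₂.2 _ hq₁.1) (hq₁.2 _ hq₂.1)
  have hf₁ : IsFiniteMeasure q₁ := hq₁.1.isFiniteMeasure
  have hf₂ : IsFiniteMeasure q₂ := hq₂.1.isFiniteMeasure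
  set α₁ := q₁.map Prod.fst with hα₁
  set α₂ := q₂.map Prod.fst with hα₂
  have hle₁ : α₁ ≤ lam := hq₁.1.fst_le
  have hle₂ : α₂ ≤ lam := hq₂.1.fst_le
  have half2 : (2⁻¹ : ℝ≥0∞) + 2⁻¹ = 1 := ENNReal.inv_two_add_inv_two
  set ρ₁ := α₁.rnDeriv lam
  set ρ₂ := α₂.rnDeriv lam
  have hρ₁ : lam.withDensity ρ₁ = α₁ :=
    Measure.withDensity_rnDeriv_eq _ _ (Measure.absolutelyContinuous_of_le hle₁)
  have hρ₂ : lam.withDensity ρ₂ = α₂ :=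
    Measure.withDensity_rnDeriv_eq _ _ (Measure.absolutelyContinuous_of_le hle₂)
  have hm₁ : Measurable ρ₁ := Measure.measurable_rnDeriv _ _
  have hm₂ : Measurable ρ₂ := Measure.measurable_rnDeriv _ _
  have h1₁ : ρ₁ ≤ᵐ[lam] 1 := Measure.rnDeriv_le_one_of_le hle₁
  have h1₂ : ρ₂ ≤ᵐ[lam] 1 := Measure.rnDeriv_le_one_of_le hle₂
  set q := (2⁻¹ : ℝ≥0∞) • (q₁ + q₂) with hqdef
  have hqfst : q.map Prod.fst = lam.withDensity fun x => 2⁻¹ * (ρ₁ x + ρ₂ x) := by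
    have : (fun x => 2⁻¹ * (ρ₁ x + ρ₂ x)) = (2⁻¹ : ℝ≥0∞) • (ρ₁ + ρ₂) := rfl
    rw [this, withDensity_smul _ (hm₁.add hm₂), withDensity_add_left hm₁, hρ₁, hρ₂, hqdef,
      Measure.map_smul, Measure.map_add _ _ measurable_fst]
  have hq : IsMinimizer {r | IsSemicoupling lam nu r} (transportCost ϑ) q := by
    refine ⟨⟨?_, ?_⟩, fun r hr => ?_⟩
    · rw [hqfst]
      conv_rhs => rw [← withDensity_one (μ := lam)]
      refine withDensity_mono ?_
      filter_upwards [h1₁, h1₂] with x hx₁ hx₂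
      exact le_self_add.trans (half_add_half_tsub_le_one hx₁ hx₂)
    · rw [hqdef, Measure.map_smul, Measure.map_add _ _ measurable_snd, hq₁.1.snd_eq, hq₂.1.snd_eq,
        smul_add, ← add_smul, half2, one_smul]
    · rw [hqdef, transportCost_smul, transportCost_add, hcost, mul_add, ← add_mul, half2, one_mul]
      exact hq₁.2 r hr
  have hqfin : transportCost ϑ q < ∞ := (hq.2 _ hq₁.1).trans_lt hfin
  obtain ⟨T, hT, hgraph⟩ := exists_graph_of_isMinimizer hac hMonge hnu hq hqfin
  have hgraph' : (∀ᵐ p ∂q₁, p.2 = T p.1) ∧ ∀ᵐ p ∂q₂, p.2 = T p.1 := by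
    rwa [hqdef, Measure.ae_ennreal_smul_measure_iff (by simp), ae_add_measure_iff] at hgraph
  -- Half the excess of `ρ` over `ρ'` is dominated by the average and fits into the remaining room,
  -- so `T` fixes the points where this excess is positive.
  have key : ∀ ρ ρ' : M → ℝ≥0∞, Measurable ρ → Measurable ρ' → ρ ≤ᵐ[lam] 1 → ρ' ≤ᵐ[lam] 1 →
      q.map Prod.fst = lam.withDensity (fun x => 2⁻¹ * (ρ x + ρ' x)) →
      ∀ᵐ x ∂lam, T x ≠ x → ρ x ≤ ρ' x := by
    intro ρ ρ' hρ hρ' h1 h1' hfst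
    have hdm : Measurable fun x => 2⁻¹ * (ρ x - ρ' x) := (hρ.sub hρ').const_mul _
    have h2 := ae_eq_self_of_isMinimizer hac hϑ hMonge hnu hq hqfin hT hgraph
      (γ := lam.withDensity fun x => 2⁻¹ * (ρ x - ρ' x)) ?_ ?_
    · rw [ae_withDensity_iff hdm] at h2
      filter_upwards [h2] with x hx hTx
      by_contra hlt
      refine hTx (hx ?_)
      simpa [tsub_eq_zero_iff_le] using hlt
    · rw [hfst]
      refine withDensity_mono (ae_of_all _ fun x => ?_)
      exact mul_le_mul_right (tsub_le_self.trans le_self_add) _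
    · rw [hfst, ← withDensity_add_right _ hdm]
      conv_rhs => rw [← withDensity_one (μ := lam)]
      refine withDensity_mono ?_
      filter_upwards [h1, h1'] with x hx hx'
      exact half_add_half_tsub_le_one hx hx'
  have hE : MeasurableSet {x | T x ≠ x} := (measurableSet_eq_fun hT measurable_id).compl
  have hoff : α₁.restrict {x | T x ≠ x} = α₂.restrict {x | T x ≠ x} := by
    rw [← hρ₁, ← hρ₂, restrict_withDensity hE, restrict_withDensity hE]
    refine withDensity_congr_ae ((ae_restrict_iff' hE).2 ?_)
    filter_upwards [key ρ₁ ρ₂ hm₁ hm₂ h1₁ h1₂ hqfst,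
      key ρ₂ ρ₁ hm₂ hm₁ h1₂ h1₁ (by rw [hqfst]; simp only [add_comm])] with x hx hx' hTx
    exact le_antisymm (hx hTx) (hx' hTx)
  -- On its fixed points `T` transports nothing, so after cancelling the common part off them, the
  -- equality of second marginals becomes one of first marginals.
  have hon : ∀ α : Measure M,
      (α.restrict {x | T x ≠ x}ᶜ).map T = α.restrict {x | T x ≠ x}ᶜ := fun α => by
    conv_rhs => rw [← Measure.map_id (μ := α.restrict {x | T x ≠ x}ᶜ)]
    refine Measure.map_congr ((ae_restrict_iff' hE.compl).2 (ae_of_all _ fun x hx => ?_))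
    simpa using hx
  have hsnd : α₁.map T = α₂.map T := by
    rw [hα₁, hα₂, ← map_snd_eq_of_ae_graph hT hgraph'.1, ← map_snd_eq_of_ae_graph hT hgraph'.2,
      hq₁.1.snd_eq, hq₂.1.snd_eq]
  have hα : α₁ = α₂ := by
    rw [← Measure.restrict_add_restrict_compl (μ := α₁) hE,
      ← Measure.restrict_add_restrict_compl (μ := α₂) hE, Measure.map_add _ _ hT,
      Measure.map_add _ _ hT, hon, hon, hoff] at hsnd
    rw [← Measure.restrict_add_restrict_compl (μ := α₁) hE,
      ← Measure.restrict_add_restrict_compl (μ := α₂) hE, hoff,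
      add_left_cancel_of_isFiniteMeasure hsnd]
  rw [eq_map_graph hT hgraph'.1, eq_map_graph hT hgraph'.2, ← hα₁, ← hα₂, hα]

/-- If the first measure has infinite mass, there is a semicoupling of finite cost. -/
theorem exists_isSemicoupling_transportCost_lt_top [Nonempty M] [IsLocallyFiniteMeasure lam]
    (hlam : lam univ = ∞) (hϑ : IsScaleFunction ϑ) [IsFiniteMeasure nu]
    (hnu : ∃ L, IsCompact L ∧ nu Lᶜ = 0) :
    ∃ r, IsSemicoupling lam nu r ∧ transportCost ϑ r < ∞ := by
  obtain ⟨x0⟩ := ‹Nonempty M›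
  obtain ⟨L, hL, hL0⟩ := hnu
  have htend : Tendsto (fun n : ℕ => lam (Metric.closedBall x0 n)) atTop (𝓝 ∞) := by
    rw [← hlam, ← Metric.iUnion_closedBall_nat x0]
    exact tendsto_measure_iUnion_atTop fun a b hab =>
      Metric.closedBall_subset_closedBall (Nat.cast_le.2 hab)
  obtain ⟨n, hn⟩ := (htend.eventually (lt_mem_nhds (measure_lt_top nu univ))).exists
  set B := Metric.closedBall x0 (n : ℝ)
  have hB : IsCompact B := isCompact_closedBall _ _
  have hB0 : lam B ≠ 0 := (zero_le.trans_lt hn).ne'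
  have hBtop : lam B ≠ ∞ := hB.measure_lt_top.ne
  have : IsFiniteMeasure (lam.restrict B) := ⟨by simpa using hBtop.lt_top⟩
  -- The mass of `B` exceeds that of `nu`, so the normalized product uses at most `lam`; its cost is
  -- bounded since `B` and `L` are compact.
  set r := (lam B)⁻¹ • ((lam.restrict B).prod nu)
  have hr : IsSemicoupling lam nu r := by
    constructor
    · have h1 : r.map Prod.fst = ((lam B)⁻¹ * nu univ) • lam.restrict B := by
        rw [Measure.map_smul, Measure.map_fst_prod, smul_smul]
      rw [h1]
      refine le_trans ?_ (Measure.restrict_le_self (s := B))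
      have h2 : (lam B)⁻¹ * nu univ ≤ 1 := by
        rw [← ENNReal.inv_mul_cancel hB0 hBtop]
        gcongr
      refine Measure.le_iff.2 fun s _ => ?_
      simpa using mul_le_mul_left h2 (lam.restrict B s)
    · rw [Measure.map_smul, Measure.map_snd_prod, smul_smul]
      simp [ENNReal.inv_mul_cancel hB0 hBtop]
  refine ⟨r, hr, ?_⟩
  have : IsFiniteMeasure r := hr.isFiniteMeasure
  have hcont : Continuous fun p : M × M => ϑ (nndist p.1 p.2) := hϑ.continuous.comp continuous_nndist
  obtain ⟨C, hC⟩ := ((hB.prod hL).image hcont).bddAbove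
  have hae : ∀ᵐ p ∂r, (ϑ (nndist p.1 p.2) : ℝ≥0∞) ≤ C := by
    have h1 : ∀ᵐ p ∂((lam.restrict B).prod nu), p.1 ∈ B ∧ p.2 ∈ L := by
      refine Filter.Eventually.and ?_ ?_
      · exact Measure.quasiMeasurePreserving_fst.ae (ae_restrict_mem measurableSet_closedBall)
      · exact Measure.quasiMeasurePreserving_snd.ae (measure_eq_zero_iff_ae_notMem.1 hL0 |>.mono fun x hx => by simpa using hx)
    refine Measure.ae_smul_measure ?_ _
    filter_upwards [h1] with p hp
    exact ENNReal.coe_le_coe.2 (hC ⟨p, hp, rfl⟩)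
  calc transportCost ϑ r ≤ ∫⁻ _, C ∂r := lintegral_mono_ae hae
    _ < ∞ := by
      rw [lintegral_const]
      exact ENNReal.mul_lt_top ENNReal.coe_lt_top (measure_lt_top _ _)

end UniqueSemicoupling

/-! ### The optimization problem as a supremum of continuous functionals -/

section PenalizedCost

theorem continuous_lintegral_of_le {X : Type*} [TopologicalSpace X] [MeasurableSpace X]
    [OpensMeasurableSpace X] {f : X → ℝ≥0} (hf : Continuous f) (k : ℝ≥0) (hk : ∀ x, f x ≤ k) :
    Continuous fun μ : ProbabilityMeasure X => ∫⁻ x, f x ∂(μ : Measure X) := by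
  refine ProbabilityMeasure.continuous_lintegral_boundedContinuousFunction
    (BoundedContinuousFunction.mkOfBound ⟨f, hf⟩ k fun x y => ?_)
  have hx : (f x : ℝ) ≤ k := hk x
  have hy : (f y : ℝ) ≤ k := hk y
  rw [NNReal.dist_eq, abs_le]
  constructor <;> simp only [ContinuousMap.coe_mk] <;>
    linarith [(f x).coe_nonneg, (f y).coe_nonneg]

variable {M : Type*} [MetricSpace M]

/-- The cost function, increased off the set of pairs whose second entry has distance at most `r`
from `x0`. -/
def coerciveCost (ϑ : ℝ≥0 → ℝ≥0) (x0 : M) (r : ℝ≥0) (p : M × M) : ℝ≥0 :=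
  ϑ (nndist p.1 p.2) + (nndist p.2 x0 - r)

theorem continuous_coerciveCost {ϑ : ℝ≥0 → ℝ≥0} (hϑ : Continuous ϑ) (x0 : M) (r : ℝ≥0) :
    Continuous (coerciveCost ϑ x0 r) := by
  unfold coerciveCost
  fun_prop

variable [ProperSpace M]

/-- The transport cost alone does not see pairs escaping along the diagonal. The penalty confines
the second entry, and growth of `ϑ` then confines the first. -/
theorem isCompact_coerciveCost_le {ϑ : ℝ≥0 → ℝ≥0} (hϑ : IsScaleFunction ϑ) (x0 : M) (r k : ℝ≥0) :
    IsCompact {p | coerciveCost ϑ x0 r p ≤ k} := by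
  obtain ⟨R, hR⟩ := (hϑ.tendsto.eventually_gt_atTop k).exists
  refine (isCompact_closedBall (x0, x0) ((R + (k + r) : ℝ≥0) : ℝ)).of_isClosed_subset
    (isClosed_le (continuous_coerciveCost hϑ.continuous x0 r) continuous_const) ?_
  rintro ⟨x, y⟩ hp
  have hp' : ϑ (nndist x y) + (nndist y x0 - r) ≤ k := hp
  have h1 : nndist x y ≤ R :=
    (hϑ.strictMono.lt_iff_lt.1 ((le_self_add.trans hp').trans_lt hR)).le
  have h2 : nndist y x0 ≤ k + r := tsub_le_iff_right.1 (le_add_self.trans hp')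
  have h3 : nndist x x0 ≤ R + (k + r) := (nndist_triangle x y x0).trans (add_le_add h1 h2)
  rw [Metric.mem_closedBall, Prod.dist_eq, max_le_iff]
  exact ⟨NNReal.coe_le_coe.2 h3, NNReal.coe_le_coe.2 (h2.trans le_add_self)⟩

variable [MeasurableSpace M] [BorelSpace M]

/-- Prokhorov's theorem: Markov's inequality for the cost truncated at `k` leaves mass at most `a /
k` off a compact sublevel set. The finitely many indices not yet covered for this `k` are tight
individually. -/
theorem exists_tendsto_of_lintegral_coerciveCost_le {ϑ : ℝ≥0 → ℝ≥0} (hϑ : IsScaleFunction ϑ)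
    (x0 : M) (r : ℝ≥0) {a : ℝ≥0∞} (ha : a < ∞) (u : ℕ → ProbabilityMeasure (M × M))
    (hu : ∀ k : ℕ, ∀ᶠ N in atTop,
      ∫⁻ p, (min (coerciveCost ϑ x0 r p) k : ℝ≥0) ∂(u N : Measure (M × M)) ≤ a) :
    ∃ e, ∃ ψ : ℕ → ℕ, StrictMono ψ ∧ Tendsto (u ∘ ψ) atTop (𝓝 e) := by
  have htight : IsTightMeasureSet {x | ∃ μ ∈ range u, ((μ : ProbabilityMeasure (M × M)) : Measure (M × M)) = x} := by
    rw [isTightMeasureSet_iff_exists_isCompact_measure_compl_le]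
    intro ε hε
    obtain ⟨k, hk0, hk⟩ : ∃ k : ℕ, 0 < k ∧ a / k ≤ ε := by
      have h1 : Tendsto (fun n : ℕ => a / n) atTop (𝓝 0) := by
        have := ENNReal.Tendsto.const_mul (a := a) ENNReal.tendsto_inv_nat_nhds_zero (Or.inr ha.ne)
        simpa [div_eq_mul_inv] using this
      obtain ⟨k, hk, hk0⟩ := ((h1.eventually (ge_mem_nhds hε)).and (eventually_gt_atTop 0)).exists
      exact ⟨k, hk0, hk⟩
    obtain ⟨N0, hN0⟩ := eventually_atTop.1 (hu k)
    have hsingle : ∀ N, ∃ K, IsCompact K ∧ (u N : Measure (M × M)) Kᶜ ≤ ε := fun N => by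
      have := isTightMeasureSet_iff_exists_isCompact_measure_compl_le.1
        (isTightMeasureSet_singleton (μ := (u N : Measure (M × M)))) ε hε
      obtain ⟨K, hK, h⟩ := this
      exact ⟨K, hK, h _ rfl⟩
    choose K hK hKε using hsingle
    refine ⟨{p | coerciveCost ϑ x0 r p ≤ k} ∪ ⋃ N ∈ Finset.range N0, K N,
      (isCompact_coerciveCost_le hϑ x0 r k).union
        ((Finset.range N0).isCompact_biUnion fun N _ => hK N), ?_⟩
    rintro _ ⟨_, ⟨N, rfl⟩, rfl⟩
    by_cases hN : N < N0
    · refine (measure_mono (compl_subset_compl.2 ?_)).trans (hKε N)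
      exact (subset_biUnion_of_mem (u := K) (Finset.mem_coe.2 (Finset.mem_range.2 hN))).trans subset_union_right
    · refine (measure_mono (compl_subset_compl.2 subset_union_left)).trans (le_trans ?_ hk)
      have hmeas : Measurable fun p : M × M => ((min (coerciveCost ϑ x0 r p) k : ℝ≥0) : ℝ≥0∞) :=
        ((continuous_coerciveCost hϑ.continuous x0 r).min continuous_const).measurable.coe_nnreal_ennreal
      refine le_trans (measure_mono ?_) ((meas_ge_le_lintegral_div hmeas.aemeasurable
        (ε := (k : ℝ≥0∞)) (by simpa using hk0.ne') (by simp)).trans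
        (ENNReal.div_le_div_right (hN0 N (not_lt.1 hN)) _))
      intro p hp
      have : (k : ℝ≥0) < coerciveCost ϑ x0 r p := not_le.1 hp
      show (k : ℝ≥0∞) ≤ _
      rw [min_eq_right this.le]
      simp
  obtain ⟨e, -, ψ, hψ, he⟩ := (isCompact_closure_of_isTightMeasureSet htight).tendsto_subseq
    (x := u) fun n => subset_closure (mem_range_self n)
  exact ⟨e, ψ, hψ, he⟩

/-- Functionals on the probability measures on `M × M` whose supremum is the transport cost on the
normalized semicouplings of `lam` and `nu`, and infinite elsewhere. -/
noncomputable def penalizedCost (ϑ : ℝ≥0 → ℝ≥0) (x0 : M) (r : ℝ≥0) (lam nu : Measure M) :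
    ℕ ⊕ (ℕ × ℕ) ⊕ (ℕ × ℕ) → ProbabilityMeasure (M × M) → ℝ≥0∞
  -- Truncation at `k` gives weak continuity. In the penalties, the factor `i` makes the supremum
  -- infinite as soon as one marginal inequality fails.
  | .inl k, e => ∫⁻ p, (min (coerciveCost ϑ x0 r p) k : ℝ≥0) ∂(e : Measure (M × M))
  | .inr (.inl (i, j)), e => i * (nu univ * ∫⁻ p, testFunction M j p.1 ∂(e : Measure (M × M)) -
      ∫⁻ x, testFunction M j x ∂lam)
  | .inr (.inr (i, j)), e => i * (nu univ * ∫⁻ p, testFunction M j p.2 ∂(e : Measure (M × M)) -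
      ∫⁻ x, testFunction M j x ∂nu)

theorem continuous_penalizedCost {ϑ : ℝ≥0 → ℝ≥0} (hϑ : Continuous ϑ) (x0 : M) (r : ℝ≥0)
    (lam nu : Measure M) [IsFiniteMeasure nu] (i : ℕ ⊕ (ℕ × ℕ) ⊕ (ℕ × ℕ)) :
    Continuous (penalizedCost ϑ x0 r lam nu i) := by
  have hpen : ∀ (n : ℕ) (C : ℝ≥0∞) (F : ProbabilityMeasure (M × M) → ℝ≥0∞), Continuous F →
      Continuous fun e => n * (nu univ * F e - C) := fun n C F hF =>
    (ENNReal.continuous_const_mul (by simp)).comp ((ENNReal.continuous_sub_right C).comp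
      ((ENNReal.continuous_const_mul (measure_ne_top _ _)).comp hF))
  rcases i with k | ⟨n, j⟩ | ⟨n, j⟩
  · exact continuous_lintegral_of_le ((continuous_coerciveCost hϑ x0 r).min continuous_const) k
      fun x => min_le_right _ _
  · exact hpen n _ _ (ProbabilityMeasure.continuous_lintegral_boundedContinuousFunction
      ((testFunction M j).compContinuous ⟨Prod.fst, continuous_fst⟩))
  · exact hpen n _ _ (ProbabilityMeasure.continuous_lintegral_boundedContinuousFunction
      ((testFunction M j).compContinuous ⟨Prod.snd, continuous_snd⟩))

theorem le_of_iSup_nat_mul_tsub_lt_top {a b : ℝ≥0∞} (h : ⨆ i : ℕ, i * (a - b) < ∞) : a ≤ b := by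
  by_contra hlt
  have h0 : a - b ≠ 0 := by simpa [tsub_eq_zero_iff_le] using hlt
  rw [← ENNReal.iSup_mul, ENNReal.iSup_natCast, ENNReal.top_mul h0] at h
  exact lt_irrefl _ h

section

variable {ϑ : ℝ≥0 → ℝ≥0} {x0 : M} {r : ℝ≥0} {lam nu : Measure M} [IsLocallyFiniteMeasure lam]
  [IsFiniteMeasure nu] {e : ProbabilityMeasure (M × M)}

theorem lintegral_testFunction_map {f : M × M → M} (hf : Measurable f) (s : ℝ≥0∞) (j : ℕ) :
    ∫⁻ x, testFunction M j x ∂((s • (e : Measure (M × M))).map f) =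
      s * ∫⁻ p, testFunction M j (f p) ∂(e : Measure (M × M)) := by
  rw [Measure.map_smul, lintegral_smul_measure, lintegral_map (measurable_testFunction j) hf,
    smul_eq_mul]

/-- Only inequalities are penalized; for the second marginal, equality follows because both measures
have total mass `nu univ`. -/
theorem isSemicoupling_of_iSup_penalizedCost_lt_top
    (h : ⨆ i, penalizedCost ϑ x0 r lam nu i e < ∞) :
    IsSemicoupling lam nu (nu univ • (e : Measure (M × M))) := by
  constructor
  · refine measure_le_of_testFunction fun j => ?_
    rw [lintegral_testFunction_map measurable_fst]
    refine le_of_iSup_nat_mul_tsub_lt_top (lt_of_le_of_lt (iSup_le fun i => ?_) h)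
    exact le_iSup (fun i => penalizedCost ϑ x0 r lam nu i e) (.inr (.inl (i, j)))
  · have : IsFiniteMeasure ((nu univ • (e : Measure (M × M))).map Prod.snd) := by
      have : IsFiniteMeasure (nu univ • (e : Measure (M × M))) :=
        Measure.smul_finite _ (measure_ne_top _ _)
      infer_instance
    refine Measure.eq_of_le_of_measure_univ_eq (measure_le_of_testFunction fun j => ?_) ?_
    · rw [lintegral_testFunction_map measurable_snd]
      refine le_of_iSup_nat_mul_tsub_lt_top (lt_of_le_of_lt (iSup_le fun i => ?_) h)
      exact le_iSup (fun i => penalizedCost ϑ x0 r lam nu i e) (.inr (.inr (i, j)))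
    · rw [Measure.map_apply measurable_snd MeasurableSet.univ]
      simp

omit [IsLocallyFiniteMeasure lam] [IsFiniteMeasure nu] in
-- All penalties vanish on semicouplings, including the one in `coerciveCost`, since `nu` lives on
-- the ball; monotone convergence removes the truncation.
theorem iSup_penalizedCost_eq (hϑ : IsScaleFunction ϑ) (hnu0 : nu univ ≠ 0)
    (hnu : nu (Metric.closedBall x0 r)ᶜ = 0)
    (h : IsSemicoupling lam nu (nu univ • (e : Measure (M × M)))) :
    ⨆ i, penalizedCost ϑ x0 r lam nu i e = transportCost ϑ (e : Measure (M × M)) := by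
  have hpen₁ : ∀ i j, penalizedCost ϑ x0 r lam nu (.inr (.inl (i, j))) e = 0 := fun i j => by
    have : ∫⁻ x, testFunction M j x ∂((nu univ • (e : Measure (M × M))).map Prod.fst) ≤
      ∫⁻ x, testFunction M j x ∂lam := lintegral_mono' h.fst_le le_rfl
    rw [lintegral_testFunction_map measurable_fst] at this
    simp [penalizedCost, tsub_eq_zero_of_le this]
  have hpen₂ : ∀ i j, penalizedCost ϑ x0 r lam nu (.inr (.inr (i, j))) e = 0 := fun i j => by
    have : ∫⁻ x, testFunction M j x ∂((nu univ • (e : Measure (M × M))).map Prod.snd) ≤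
      ∫⁻ x, testFunction M j x ∂nu := lintegral_mono' h.snd_eq.le le_rfl
    rw [lintegral_testFunction_map measurable_snd] at this
    simp [penalizedCost, tsub_eq_zero_of_le this]
  have hcost : transportCost ϑ (e : Measure (M × M)) =
      ∫⁻ p, (coerciveCost ϑ x0 r p : ℝ≥0) ∂(e : Measure (M × M)) := by
    have h1 : ∀ᵐ p ∂(nu univ • (e : Measure (M × M))), p.2 ∈ Metric.closedBall x0 (r : ℝ) := by
      refine ae_of_ae_map measurable_snd.aemeasurable ?_
      rw [h.snd_eq]
      exact hnu
    rw [Measure.ae_ennreal_smul_measure_iff hnu0] at h1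
    refine lintegral_congr_ae ?_
    filter_upwards [h1] with p hp
    have : nndist p.2 x0 ≤ r := hp
    simp [coerciveCost, tsub_eq_zero_of_le this]
  have hmono : ∫⁻ p, (coerciveCost ϑ x0 r p : ℝ≥0) ∂(e : Measure (M × M)) =
      ⨆ k : ℕ, penalizedCost ϑ x0 r lam nu (.inl k) e := by
    simp only [penalizedCost]
    rw [← lintegral_iSup]
    · refine lintegral_congr fun p => ?_
      refine le_antisymm ?_ (iSup_le fun k => ENNReal.coe_le_coe.2 (min_le_left _ _))
      obtain ⟨k, hk⟩ := exists_nat_ge (coerciveCost ϑ x0 r p)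
      refine le_iSup_of_le k ?_
      rw [min_eq_left hk]
    · exact fun k => ((continuous_coerciveCost hϑ.continuous x0 r).min
        continuous_const).measurable.coe_nnreal_ennreal
    · exact fun a b hab p => ENNReal.coe_le_coe.2 (min_le_min_left _ (Nat.cast_le.2 hab))
  rw [hcost, hmono, iSup_sum, iSup_sum, iSup_prod, iSup_prod]
  simp [hpen₁, hpen₂]

omit [MetricSpace M] [ProperSpace M] [BorelSpace M] [IsLocallyFiniteMeasure lam] in
theorem exists_smul_eq_of_isSemicoupling (hnu0 : nu univ ≠ 0) {q : Measure (M × M)}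
    (hq : IsSemicoupling lam nu q) :
    ∃ e : ProbabilityMeasure (M × M), nu univ • (e : Measure (M × M)) = q := by
  have hqu : q univ = nu univ := by
    rw [← hq.snd_eq, Measure.map_apply measurable_snd MeasurableSet.univ, preimage_univ]
  have htop : nu univ ≠ ∞ := measure_ne_top _ _
  refine ⟨⟨(nu univ)⁻¹ • q, ⟨?_⟩⟩, ?_⟩
  · simp [hqu, ENNReal.inv_mul_cancel hnu0 htop]
  · rw [ProbabilityMeasure.coe_mk, smul_smul, ENNReal.mul_inv_cancel hnu0 htop, one_smul]

omit [IsLocallyFiniteMeasure lam] in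
theorem exists_iSup_penalizedCost_lt_top (hϑ : IsScaleFunction ϑ) (hnu0 : nu univ ≠ 0)
    (hnu : nu (Metric.closedBall x0 r)ᶜ = 0)
    (hex : ∃ r, IsSemicoupling lam nu r ∧ transportCost ϑ r < ∞) :
    ∃ e, ⨆ i, penalizedCost ϑ x0 r lam nu i e < ∞ := by
  obtain ⟨q, hq, hfin⟩ := hex
  obtain ⟨e, rfl⟩ := exists_smul_eq_of_isSemicoupling hnu0 hq
  refine ⟨e, ?_⟩
  rw [iSup_penalizedCost_eq hϑ hnu0 hnu hq]
  rw [transportCost_smul] at hfin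
  exact ENNReal.lt_top_of_mul_ne_top_right hfin.ne hnu0

theorem isMinimizer_of_penalizedCost (hϑ : IsScaleFunction ϑ) (hnu0 : nu univ ≠ 0)
    (hnu : nu (Metric.closedBall x0 r)ᶜ = 0)
    (hex : ∃ r, IsSemicoupling lam nu r ∧ transportCost ϑ r < ∞)
    (he : ∀ b, ⨆ i, penalizedCost ϑ x0 r lam nu i e ≤ ⨆ i, penalizedCost ϑ x0 r lam nu i b) :
    IsMinimizer {q | IsSemicoupling lam nu q} (transportCost ϑ)
      (nu univ • (e : Measure (M × M))) := by
  obtain ⟨b, hb⟩ := exists_iSup_penalizedCost_lt_top hϑ hnu0 hnu hex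
  have hesc := isSemicoupling_of_iSup_penalizedCost_lt_top ((he b).trans_lt hb)
  refine ⟨hesc, fun q hq => ?_⟩
  obtain ⟨b', rfl⟩ := exists_smul_eq_of_isSemicoupling hnu0 hq
  have h1 := he b'
  rw [iSup_penalizedCost_eq hϑ hnu0 hnu hesc, iSup_penalizedCost_eq hϑ hnu0 hnu hq] at h1
  rw [transportCost_smul, transportCost_smul]
  gcongr

end

end PenalizedCost

/-! ### Measurable choice of the optimal semicoupling -/

section MeasurableMinimizer

variable {M : Type*} [MetricSpace M] [ProperSpace M] [Nonempty M] [MeasurableSpace M]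
  [BorelSpace M] {m : Measure M} {ϑ : ℝ≥0 → ℝ≥0}

/-- Optimal semicouplings of random measures can be chosen measurably. -/
theorem exists_measurable_isMinimizer {Ω : Type*} [MeasurableSpace Ω] (P : Measure Ω)
    {lam nu : Ω → Measure M} (hlam : Measurable lam) (hlam_fin : ∀ ω, IsLocallyFiniteMeasure (lam ω))
    (hnu : Measurable nu) (hnu_fin : ∀ ω, IsFiniteMeasure (nu ω)) (x0 : M) (r : ℝ≥0)
    (hnu_supp : ∀ ω, nu ω (Metric.closedBall x0 r)ᶜ = 0)
    (hlam_ac : ∀ᵐ ω ∂P, lam ω ≪ m) (hlam_top : ∀ᵐ ω ∂P, lam ω univ = ∞)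
    (hϑ : IsScaleFunction ϑ) (hMonge : UniqueMongeSolutions m ϑ) :
    ∃ q : Ω → Measure (M × M), Measurable q ∧ (∀ ω, IsFiniteMeasure (q ω)) ∧
      ∀ᵐ ω ∂P, IsUniqueMinimizer {r | IsSemicoupling (lam ω) (nu ω) r} (transportCost ϑ) (q ω) ∧
        transportCost ϑ (q ω) < ∞ := by
  classical
  obtain ⟨enum, henum⟩ := exists_surjective_nat (ℕ ⊕ (ℕ × ℕ) ⊕ (ℕ × ℕ))
  have hne : Nonempty (ProbabilityMeasure (M × M)) :=
    ⟨⟨Measure.dirac (x0, x0), inferInstance⟩⟩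
  have hsup : ∀ ω e, ⨆ n, penalizedCost ϑ x0 r (lam ω) (nu ω) (enum n) e =
      ⨆ i, penalizedCost ϑ x0 r (lam ω) (nu ω) i e := fun ω e =>
    henum.iSup_comp fun i => penalizedCost ϑ x0 r (lam ω) (nu ω) i e
  have hnu_univ : Measurable fun ω => nu ω univ := Measure.measurable_measure.1 hnu _ MeasurableSet.univ
  have hpmeas : ∀ i e, Measurable fun ω => penalizedCost ϑ x0 r (lam ω) (nu ω) i e := by
    rintro (k | ⟨n, j⟩ | ⟨n, j⟩) e
    · exact measurable_const
    · exact ((hnu_univ.mul_const _).sub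
        ((Measure.measurable_lintegral (measurable_testFunction j)).comp hlam)).const_mul _
    · exact ((hnu_univ.mul_const _).sub
        ((Measure.measurable_lintegral (measurable_testFunction j)).comp hnu)).const_mul _
  obtain ⟨d, k, hk, hlim⟩ := exists_measurable_tendsto_argmin
    (fun n ω e => penalizedCost ϑ x0 r (lam ω) (nu ω) (enum n) e)
    (fun n ω => continuous_penalizedCost hϑ.continuous x0 r _ _ _) (fun n e => hpmeas _ e)
  have hgood : ∀ᵐ ω ∂P, lam ω ≪ m ∧ lam ω univ = ∞ := hlam_ac.and hlam_top
  obtain ⟨S, hS, hSmeas, hS0⟩ := exists_measurable_superset_of_null (ae_iff.1 hgood)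
  have hSgood : ∀ ω ∉ S, lam ω ≪ m ∧ lam ω univ = ∞ := fun ω hω => by
    by_contra h
    exact hω (hS h)
  -- Normalization requires `nu ω ≠ 0`. Where `nu ω = 0`, the zero measure is optimal.
  set G : Set Ω := Sᶜ ∩ {ω | nu ω univ ≠ 0}
  have hG : MeasurableSet G := hSmeas.compl.inter (hnu_univ (measurableSet_singleton 0)).compl
  have hcpt : ∀ ω, ∃ L, IsCompact L ∧ nu ω Lᶜ = 0 := fun ω =>
    ⟨_, isCompact_closedBall x0 r, hnu_supp ω⟩
  have hex : ∀ ω ∉ S, ∃ r, IsSemicoupling (lam ω) (nu ω) r ∧ transportCost ϑ r < ∞ := fun ω hω =>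
    exists_isSemicoupling_transportCost_lt_top (hSgood ω hω).2 hϑ (hcpt ω)
  have hunique : ∀ ω ∉ S, ∀ q, IsMinimizer {r | IsSemicoupling (lam ω) (nu ω) r} (transportCost ϑ) q →
      IsUniqueMinimizer {r | IsSemicoupling (lam ω) (nu ω) r} (transportCost ϑ) q ∧
        transportCost ϑ q < ∞ := by
    intro ω hω q hq
    obtain ⟨r, hr, hrfin⟩ := hex ω hω
    have hfin := (hq.2 r hr).trans_lt hrfin
    exact ⟨⟨hq, fun b hb => (eq_of_isMinimizer (hSgood ω hω).1 hϑ hMonge (hcpt ω) hq hb hfin).symm⟩, hfin⟩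
  have hlimit : ∀ ω ∈ G, ∃ e : ProbabilityMeasure (M × M),
      IsMinimizer {r | IsSemicoupling (lam ω) (nu ω) r} (transportCost ϑ)
        (nu ω univ • (e : Measure (M × M))) ∧ Tendsto (fun N => d (k N ω)) atTop (𝓝 e) := by
    rintro ω ⟨hωS, hω0 : nu ω univ ≠ 0⟩
    have hmin : ∀ e, (∀ b, ⨆ n, penalizedCost ϑ x0 r (lam ω) (nu ω) (enum n) e ≤
          ⨆ n, penalizedCost ϑ x0 r (lam ω) (nu ω) (enum n) b) →
        IsMinimizer {r | IsSemicoupling (lam ω) (nu ω) r} (transportCost ϑ)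
          (nu ω univ • (e : Measure (M × M))) := fun e he =>
      isMinimizer_of_penalizedCost hϑ hω0 (hnu_supp ω) (hex ω hωS) (by simpa only [hsup] using he)
    have hfin : ∃ e, ⨆ n, penalizedCost ϑ x0 r (lam ω) (nu ω) (enum n) e < ∞ := by
      simpa only [hsup] using exists_iSup_penalizedCost_lt_top hϑ hω0 (hnu_supp ω) (hex ω hωS)
    obtain ⟨e, he, hlim⟩ := hlim ω hfin (fun a ha u hu => by
      refine exists_tendsto_of_lintegral_coerciveCost_le hϑ x0 r ha u fun i => ?_
      obtain ⟨n, hn⟩ := henum (.inl i)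
      simpa only [hn, penalizedCost] using hu n) (fun e e' he he' => by
      have h1 := (hunique ω hωS _ (hmin e he)).1.2 _ (hmin e' he')
      refine ProbabilityMeasure.toMeasure_injective ?_
      have h2 := congrArg (fun μ => (nu ω univ)⁻¹ • μ) h1
      simp only [smul_smul, ENNReal.inv_mul_cancel hω0 (measure_ne_top (nu ω) univ), one_smul] at h2
      exact h2.symm)
    exact ⟨e, hmin e he, hlim⟩
  choose! e he using hlimit
  let δ : ProbabilityMeasure (M × M) := ⟨Measure.dirac (x0, x0), inferInstance⟩
  let e' : Ω → ProbabilityMeasure (M × M) := fun ω => if ω ∈ G then e ω else δ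
  -- Off `G` a constant is inserted, so that the sequence converges for every `ω` and the limit is
  -- measurable.
  let x : ℕ → Ω → ProbabilityMeasure (M × M) := fun N ω => if ω ∈ G then d (k N ω) else δ
  have hx : ∀ N j, Measurable fun ω => ∫⁻ p, testFunction (M × M) j p ∂(x N ω : Measure (M × M)) := by
    intro N j
    let F : ProbabilityMeasure (M × M) → ℝ≥0∞ := fun μ =>
      ∫⁻ p, testFunction (M × M) j p ∂(μ : Measure (M × M))
    have h1 : Measurable fun ω => if ω ∈ G then F (d (k N ω)) else F δ :=
      Measurable.ite hG ((measurable_from_nat (f := fun n => F (d n))).comp (hk N)) measurable_const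
    convert h1 using 2 with ω
    by_cases hω : ω ∈ G <;> simp [x, hω, F]
  have he' : Measurable fun ω => (e' ω : Measure (M × M)) := by
    refine measurable_of_tendsto_probabilityMeasure hx fun ω => ?_
    by_cases hω : ω ∈ G
    · simpa only [x, e', hω, if_true] using (he ω hω).2
    · simp only [x, e', hω, if_false]
      exact tendsto_const_nhds
  refine ⟨fun ω => if ω ∈ G then nu ω univ • (e' ω : Measure (M × M)) else 0, ?_, ?_, ?_⟩
  · refine Measurable.ite hG ?_ measurable_const
    refine Measure.measurable_of_measurable_coe _ fun s hs => ?_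
    exact hnu_univ.mul (Measure.measurable_measure.1 he' s hs)
  · intro ω
    by_cases hω : ω ∈ G
    · simp only [hω, if_true]
      exact Measure.smul_finite _ (measure_ne_top _ _)
    · simp only [hω, if_false]
      infer_instance
  · have : ∀ᵐ ω ∂P, ω ∉ S := measure_eq_zero_iff_ae_notMem.1 hS0
    filter_upwards [this] with ω hω
    refine hunique ω hω _ ?_
    by_cases hω0 : nu ω univ = 0
    · have hωG : ω ∉ G := fun h => h.2 hω0
      simp only [hωG, if_false]
      have hnu0 : nu ω = 0 := Measure.measure_univ_eq_zero.1 hω0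
      refine ⟨⟨by simpa using Measure.zero_le _, by simp [hnu0]⟩, fun b _ => ?_⟩
      simp [transportCost]
    · have hωG : ω ∈ G := ⟨hω, hω0⟩
      simp only [hωG, if_true, e']
      exact (he ω hωG).1

end MeasurableMinimizer

/-! ### Campbell measures and disintegration -/

section Campbell

variable {Ω X Y : Type*} [MeasurableSpace Ω] [MeasurableSpace X] [MeasurableSpace Y] {P : Measure Ω}
  {κ η : ProbabilityTheory.Kernel Ω X}

/-- The masses need not be uniformly bounded, so `Ω` is split by the integer part of the mass. -/
theorem isSFiniteKernel_of_isFiniteMeasure (κ : ProbabilityTheory.Kernel Ω X)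
    (h : ∀ ω, IsFiniteMeasure (κ ω)) : ProbabilityTheory.IsSFiniteKernel κ := by
  classical
  let N : Ω → ℕ := fun ω => ⌊(κ ω univ).toNNReal⌋₊
  have hN : Measurable N := (κ.measurable_coe MeasurableSet.univ).ennreal_toNNReal.nat_floor
  have hs : ∀ n, MeasurableSet (N ⁻¹' {n}) := fun n => hN (measurableSet_singleton n)
  have hsum : κ = ProbabilityTheory.Kernel.sum fun n => ProbabilityTheory.Kernel.piecewise (hs n) κ 0 := by
    ext ω s hsm
    rw [ProbabilityTheory.Kernel.sum_apply' _ _ hsm, tsum_eq_single (N ω)]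
    · rw [ProbabilityTheory.Kernel.piecewise_apply]
      simp
    · intro n hn
      rw [ProbabilityTheory.Kernel.piecewise_apply]
      simp [hn.symm]
  rw [hsum]
  have : ∀ n, ProbabilityTheory.IsFiniteKernel (ProbabilityTheory.Kernel.piecewise (hs n) κ 0) := by
    intro n
    refine ⟨⟨(n + 1 : ℝ≥0), ENNReal.coe_lt_top, fun ω => ?_⟩⟩
    rw [ProbabilityTheory.Kernel.piecewise_apply]
    split_ifs with hω
    · have h1 : N ω = n := hω
      have h2 := (Nat.lt_floor_add_one ((κ ω univ).toNNReal)).le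
      change _ ≤ (N ω : ℝ≥0) + 1 at h2
      rw [h1] at h2
      rw [← ENNReal.coe_toNNReal (measure_ne_top (κ ω) univ)]
      exact ENNReal.coe_le_coe.2 h2
    · simp
  infer_instance

theorem isSFiniteKernel_of_isLocallyFiniteMeasure [TopologicalSpace X] [T2Space X]
    [SigmaCompactSpace X] [OpensMeasurableSpace X] (κ : ProbabilityTheory.Kernel Ω X)
    (h : ∀ ω, IsLocallyFiniteMeasure (κ ω)) : ProbabilityTheory.IsSFiniteKernel κ := by
  let D : ℕ → Set X := disjointed (compactCovering X)
  have hD : ∀ n, MeasurableSet (D n) := fun n =>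
    MeasurableSet.disjointed (fun n => (isCompact_compactCovering X n).measurableSet) n
  have hsum : κ = ProbabilityTheory.Kernel.sum fun n => κ.restrict (hD n) := by
    ext ω s hs
    rw [ProbabilityTheory.Kernel.sum_apply]
    simp only [ProbabilityTheory.Kernel.restrict_apply]
    rw [← Measure.restrict_iUnion (disjoint_disjointed _) hD, iUnion_disjointed,
      iUnion_compactCovering, Measure.restrict_univ]
  rw [hsum]
  have : ∀ n, ProbabilityTheory.IsSFiniteKernel (κ.restrict (hD n)) := fun n => by
    refine isSFiniteKernel_of_isFiniteMeasure _ fun ω => ⟨?_⟩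
    rw [ProbabilityTheory.Kernel.restrict_apply, Measure.restrict_apply_univ]
    exact (measure_mono (disjointed_subset _ n)).trans_lt
      (isCompact_compactCovering X n).measure_lt_top
  infer_instance

theorem measurable_map_prodMk (κ : ProbabilityTheory.Kernel Ω X)
    [ProbabilityTheory.IsSFiniteKernel κ] :
    Measurable fun ω => (κ ω).map fun x => (x, ω) := by
  refine Measure.measurable_of_measurable_coe _ fun s hs => ?_
  have h1 : (fun ω => (κ ω).map (fun x => (x, ω)) s) =
      fun ω => κ ω (Prod.mk ω ⁻¹' (Prod.swap ⁻¹' s)) := by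
    funext ω
    rw [Measure.map_apply (by fun_prop) hs]
    rfl
  rw [h1]
  exact ProbabilityTheory.Kernel.measurable_kernel_prodMk_left (measurable_swap hs)

theorem lintegral_campbell (P : Measure Ω) (κ : ProbabilityTheory.Kernel Ω X)
    [ProbabilityTheory.IsSFiniteKernel κ] {f : X × Ω → ℝ≥0∞} (hf : Measurable f) :
    ∫⁻ p, f p ∂(campbell P κ) = ∫⁻ ω, ∫⁻ x, f (x, ω) ∂(κ ω) ∂P := by
  rw [campbell, Measure.lintegral_bind (measurable_map_prodMk κ).aemeasurable hf.aemeasurable]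
  refine lintegral_congr fun ω => ?_
  rw [lintegral_map hf (by fun_prop)]

theorem campbell_apply (P : Measure Ω) (κ : ProbabilityTheory.Kernel Ω X)
    [ProbabilityTheory.IsSFiniteKernel κ] {s : Set (X × Ω)} (hs : MeasurableSet s) :
    campbell P κ s = ∫⁻ ω, κ ω ((fun x => (x, ω)) ⁻¹' s) ∂P := by
  rw [campbell, Measure.bind_apply hs (measurable_map_prodMk κ).aemeasurable]
  refine lintegral_congr fun ω => ?_
  rw [Measure.map_apply (by fun_prop) hs]

theorem campbell_mono_ae [ProbabilityTheory.IsSFiniteKernel κ]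
    [ProbabilityTheory.IsSFiniteKernel η] (h : ∀ᵐ ω ∂P, κ ω ≤ η ω) :
    campbell P κ ≤ campbell P η := by
  refine Measure.le_iff.2 fun s hs => ?_
  rw [campbell_apply P κ hs, campbell_apply P η hs]
  exact lintegral_mono_ae (h.mono fun ω hω => hω _)

theorem campbell_congr_ae [ProbabilityTheory.IsSFiniteKernel κ]
    [ProbabilityTheory.IsSFiniteKernel η] (h : ∀ᵐ ω ∂P, κ ω = η ω) :
    campbell P κ = campbell P η :=
  le_antisymm (campbell_mono_ae (h.mono fun _ => le_of_eq))
    (campbell_mono_ae (h.mono fun _ hω => hω.ge))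

theorem map_campbell [ProbabilityTheory.IsSFiniteKernel κ] {f : X → Y} (hf : Measurable f) :
    (campbell P κ).map (fun p => (f p.1, p.2)) = campbell P (κ.map f) := by
  ext s hs
  have hm : Measurable fun p : X × Ω => (f p.1, p.2) := by fun_prop
  rw [Measure.map_apply hm hs, campbell_apply P κ (hm hs), campbell_apply P _ hs]
  refine lintegral_congr fun ω => ?_
  rw [ProbabilityTheory.Kernel.map_apply' _ hf _ (hs.preimage (by fun_prop))]
  rfl

theorem map_snd_campbell [ProbabilityTheory.IsSFiniteKernel κ] :
    (campbell P κ).map Prod.snd = P.withDensity fun ω => κ ω univ := by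
  ext s hs
  rw [Measure.map_apply measurable_snd hs, campbell_apply P κ (measurable_snd hs),
    withDensity_apply _ hs, ← lintegral_indicator hs]
  refine lintegral_congr fun ω => ?_
  by_cases hω : ω ∈ s
  · have : (fun x : X => (x, ω)) ⁻¹' (Prod.snd ⁻¹' s) = univ := by ext; simp [hω]
    rw [this, indicator_of_mem hω]
  · have : (fun x : X => (x, ω)) ⁻¹' (Prod.snd ⁻¹' s) = ∅ := by ext; simp [hω]
    rw [this, indicator_of_notMem hω, measure_empty]

theorem withDensity_campbell [ProbabilityTheory.IsSFiniteKernel κ] {f : X × Ω → ℝ≥0∞}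
    (hf : Measurable f) (hf' : ∀ p, f p ≠ ∞) :
    (campbell P κ).withDensity f = campbell P (κ.withDensity fun ω x => f (x, ω)) := by
  have hm : Measurable (Function.uncurry fun ω x => f (x, ω)) := hf.comp measurable_swap
  have := ProbabilityTheory.Kernel.IsSFiniteKernel.withDensity κ (f := fun ω x => f (x, ω)) fun _ _ => hf' _
  ext s hs
  rw [withDensity_apply _ hs, ← lintegral_indicator hs, lintegral_campbell P κ (hf.indicator hs),
    campbell_apply P _ hs]
  refine lintegral_congr fun ω => ?_
  have hs' : MeasurableSet ((fun x => (x, ω)) ⁻¹' s) := hs.preimage (by fun_prop)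
  rw [ProbabilityTheory.Kernel.withDensity_apply' _ hm, ← lintegral_indicator hs']
  rfl

/-- Integrating `φ_j(x) 1_s(ω)` for all measurable `s` compares the `j`-th test integrals almost
everywhere; countability of the family leaves one exceptional null set. -/
theorem ae_le_of_campbell_le {X : Type*} [MetricSpace X] [SecondCountableTopology X]
    [MeasurableSpace X] [BorelSpace X] [SigmaFinite P] {κ η : ProbabilityTheory.Kernel Ω X}
    [ProbabilityTheory.IsSFiniteKernel κ] [ProbabilityTheory.IsSFiniteKernel η]
    (hη : ∀ᵐ ω ∂P, (η ω).OuterRegular) (h : campbell P κ ≤ campbell P η) :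
    ∀ᵐ ω ∂P, κ ω ≤ η ω := by
  have key : ∀ j, ∀ᵐ ω ∂P, ∫⁻ x, testFunction X j x ∂(κ ω) ≤ ∫⁻ x, testFunction X j x ∂(η ω) := by
    intro j
    have hφ : Measurable fun x => (testFunction X j x : ℝ≥0∞) := measurable_testFunction j
    refine ae_le_of_forall_setLIntegral_le_of_sigmaFinite hφ.lintegral_kernel fun s hs _ => ?_
    have hF : ∀ κ : ProbabilityTheory.Kernel Ω X, ProbabilityTheory.IsSFiniteKernel κ →
        ∫⁻ ω in s, ∫⁻ x, testFunction X j x ∂(κ ω) ∂P =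
          ∫⁻ p, (Prod.snd ⁻¹' s).indicator (fun p : X × Ω => (testFunction X j p.1 : ℝ≥0∞)) p
            ∂(campbell P κ) := by
      intro κ _
      have hφ' : Measurable fun p : X × Ω => (testFunction X j p.1 : ℝ≥0∞) := hφ.comp measurable_fst
      rw [lintegral_campbell P κ (hφ'.indicator (measurable_snd hs)), ← lintegral_indicator hs]
      refine lintegral_congr fun ω => ?_
      by_cases hω : ω ∈ s <;> simp [hω, indicator]
    rw [hF κ inferInstance, hF η inferInstance]
    exact lintegral_mono' h le_rfl
  filter_upwards [ae_all_iff.2 key, hη] with ω hω hreg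
  exact measure_le_of_testFunction hω

/-- The mean mass of a compact set may be infinite, so compact sets are paired with the events that
their random mass is at most an integer. -/
theorem sigmaFinite_campbell [TopologicalSpace X] [T2Space X]
    [SigmaCompactSpace X] [OpensMeasurableSpace X] [IsFiniteMeasure P]
    (κ : ProbabilityTheory.Kernel Ω X)
    (h : ∀ ω, IsLocallyFiniteMeasure (κ ω)) : SigmaFinite (campbell P κ) := by
  have := isSFiniteKernel_of_isLocallyFiniteMeasure κ h
  let K := compactCovering X
  let S : ℕ × ℕ → Set (X × Ω) := fun n => K n.1 ×ˢ {ω | κ ω (K n.1) ≤ n.2}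
  have hK : ∀ n, MeasurableSet (K n) := fun n => (isCompact_compactCovering X n).measurableSet
  have hS : ∀ n, MeasurableSet (S n) := fun n =>
    (hK _).prod (measurableSet_le (κ.measurable_coe (hK _)) measurable_const)
  refine Measure.sigmaFinite_of_countable (countable_range S) ?_ ?_
  · rintro _ ⟨n, rfl⟩
    rw [campbell_apply P κ (hS n)]
    calc _ ≤ ∫⁻ _, (n.2 : ℝ≥0∞) ∂P := by
          refine lintegral_mono fun ω => ?_
          by_cases hω : κ ω (K n.1) ≤ n.2
          · exact (measure_mono fun x hx => hx.1).trans hω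
          · have : (fun x => (x, ω)) ⁻¹' S n = ∅ := by ext; simp [S, hω]
            simp [this]
      _ < ∞ := by
          rw [lintegral_const]
          exact ENNReal.mul_lt_top (by simp) (measure_lt_top _ _)
  · refine eq_univ_of_forall fun p => ?_
    obtain ⟨n, hn⟩ := mem_iUnion.1 ((iUnion_compactCovering X).symm ▸ mem_univ p.1)
    obtain ⟨k, hk⟩ := ENNReal.exists_nat_gt
      ((isCompact_compactCovering X n).measure_lt_top (μ := κ p.2)).ne
    exact mem_sUnion.2 ⟨S (n, k), mem_range_self _, hn, hk.le⟩

/-- Kernels with locally finite values that are dominated by each other have a jointly measurable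
density. -/
theorem exists_measurable_density {X : Type*} [MetricSpace X] [ProperSpace X]
    [MeasurableSpace X] [BorelSpace X] [IsFiniteMeasure P] {κ η : ProbabilityTheory.Kernel Ω X}
    (hκ : ∀ ω, IsLocallyFiniteMeasure (κ ω)) (hη : ∀ ω, IsLocallyFiniteMeasure (η ω))
    (h : ∀ᵐ ω ∂P, κ ω ≤ η ω) :
    ∃ ρ : X × Ω → ℝ≥0∞, Measurable ρ ∧ (∀ p, ρ p ≤ 1) ∧
      ∀ᵐ ω ∂P, κ ω = (η ω).withDensity fun x => ρ (x, ω) := by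
  have hsκ := isSFiniteKernel_of_isLocallyFiniteMeasure κ hκ
  have hsη := isSFiniteKernel_of_isLocallyFiniteMeasure η hη
  have hfκ := sigmaFinite_campbell (P := P) κ hκ
  have hfη := sigmaFinite_campbell (P := P) η hη
  have hle : campbell P κ ≤ campbell P η := campbell_mono_ae h
  -- Differentiating the Campbell measures, not the kernels one `ω` at a time, yields joint
  -- measurability; the minimum makes the bound hold everywhere.
  let ρ : X × Ω → ℝ≥0∞ := fun p => min ((campbell P κ).rnDeriv (campbell P η) p) 1
  have hρ : Measurable ρ := (Measure.measurable_rnDeriv _ _).min measurable_const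
  have hρ1 : ∀ p, ρ p ≤ 1 := fun p => min_le_right _ _
  have hρtop : ∀ p, ρ p ≠ ∞ := fun p => ((hρ1 p).trans_lt ENNReal.one_lt_top).ne
  have hκη : campbell P κ = (campbell P η).withDensity ρ := by
    conv_lhs => rw [← Measure.withDensity_rnDeriv_eq _ _ (Measure.absolutelyContinuous_of_le hle)]
    refine withDensity_congr_ae ?_
    filter_upwards [Measure.rnDeriv_le_one_of_le hle] with p hp
    exact (min_eq_left hp).symm
  rw [withDensity_campbell hρ hρtop] at hκη
  have := ProbabilityTheory.Kernel.IsSFiniteKernel.withDensity η (f := fun ω x => ρ (x, ω)) fun _ _ => hρtop _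
  have hm : Measurable (Function.uncurry fun ω x => ρ (x, ω)) := hρ.comp measurable_swap
  have hreg : ∀ ω, (η.withDensity (fun ω x => ρ (x, ω)) ω).OuterRegular := fun ω => by
    have hle : η.withDensity (fun ω x => ρ (x, ω)) ω ≤ η ω := by
      rw [ProbabilityTheory.Kernel.withDensity_apply _ hm]
      conv_rhs => rw [← withDensity_one (μ := η ω)]
      exact withDensity_mono (ae_of_all _ fun x => hρ1 _)
    have := hη ω
    have := Measure.isLocallyFiniteMeasure_of_le hle
    infer_instance
  refine ⟨ρ, hρ, hρ1, ?_⟩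
  filter_upwards [ae_le_of_campbell_le (ae_of_all _ hreg) hκη.le,
    ae_le_of_campbell_le (ae_of_all _ fun ω => by have := hκ ω; infer_instance) hκη.ge] with ω h1 h2
  rw [← ProbabilityTheory.Kernel.withDensity_apply _ hm]
  exact le_antisymm h1 h2

/-- Disintegration of a measure over its second marginal. -/
theorem exists_eq_campbell [StandardBorelSpace X] [Nonempty X] [IsFiniteMeasure P]
    {R : Measure (X × Ω)} {s : Ω → ℝ≥0∞} (hs : Measurable s) (hs' : ∀ ω, s ω ≠ ∞)
    (hR : R.map Prod.snd = P.withDensity s) :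
    ∃ r : ProbabilityTheory.Kernel Ω X, (∀ ω, IsFiniteMeasure (r ω)) ∧ R = campbell P r := by
  -- `R` may be infinite. Weighting by `w = 1/(1 + s)` makes it finite, so a conditional kernel
  -- exists; the weight `v` is restored afterwards.
  let v : Ω → ℝ≥0∞ := fun ω => 1 + s ω
  have hv : Measurable v := measurable_const.add hs
  have hv0 : ∀ ω, v ω ≠ 0 := fun ω => by simp [v]
  have hvtop : ∀ ω, v ω ≠ ∞ := fun ω => by simp [v, hs']
  let w : Ω → ℝ≥0∞ := fun ω => (v ω)⁻¹
  have hw : Measurable w := hv.inv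
  have hwv : ∀ ω, w ω * v ω = 1 := fun ω => ENNReal.inv_mul_cancel (hv0 ω) (hvtop ω)
  set Qw := R.withDensity (w ∘ Prod.snd)
  have hQwsnd : Qw.map Prod.snd = P.withDensity (s * w) := by
    rw [map_withDensity_comp measurable_snd R hw, hR, ← withDensity_mul _ hs hw]
  have hsw : ∀ ω, s ω * w ω ≤ 1 := fun ω => by
    rw [← hwv ω, mul_comm]
    gcongr
    exact le_add_self
  have hfin' : IsFiniteMeasure (Qw.map Prod.snd) := by
    rw [hQwsnd]
    refine isFiniteMeasure_of_le P ?_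
    conv_rhs => rw [← withDensity_one (μ := P)]
    exact withDensity_mono (ae_of_all _ hsw)
  have hfin : IsFiniteMeasure Qw := Measure.isFiniteMeasure_of_map measurable_snd.aemeasurable
  have hQw : R = Qw.withDensity (v ∘ Prod.snd) := by
    rw [← withDensity_mul _ (hw.comp measurable_snd) (hv.comp measurable_snd)]
    have : (w ∘ Prod.snd : X × Ω → ℝ≥0∞) * (v ∘ Prod.snd) = 1 := by
      funext p
      exact hwv p.2
    rw [this, withDensity_one]
  set Qs := Qw.map Prod.swap
  have hQsfst : Qs.fst = P.withDensity (s * w) := by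
    rw [← hQwsnd, Measure.fst, Measure.map_map measurable_fst measurable_swap]
    rfl
  have hdis : (P.withDensity (s * w)).compProd Qs.condKernel = Qs := by
    rw [← hQsfst]
    exact Measure.disintegrate _ _
  let r : ProbabilityTheory.Kernel Ω X := ⟨fun ω => s ω • Qs.condKernel ω, by
    refine Measure.measurable_of_measurable_coe _ fun t ht => ?_
    exact hs.mul (Qs.condKernel.measurable_coe ht)⟩
  have hr : ∀ ω, IsFiniteMeasure (r ω) := fun ω => Measure.smul_finite _ (hs' ω)
  have := isSFiniteKernel_of_isFiniteMeasure r hr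
  refine ⟨r, hr, ?_⟩
  ext t ht
  have hm : Measurable (t.indicator (v ∘ Prod.snd)) := (hv.comp measurable_snd).indicator ht
  have hms : Measurable fun p : Ω × X => t.indicator (v ∘ Prod.snd) p.swap :=
    hm.comp measurable_swap
  have hsw_fin : IsFiniteMeasure (P.withDensity (s * w)) := hQwsnd ▸ hfin'
  have h1 : R t = ∫⁻ p, t.indicator (v ∘ Prod.snd) p.swap ∂Qs := by
    rw [lintegral_map hms measurable_swap]
    simp only [Prod.swap_swap]
    rw [lintegral_indicator ht, ← withDensity_apply _ ht, ← hQw]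
  rw [h1, ← hdis, Measure.lintegral_compProd hms, campbell_apply P r ht,
    lintegral_withDensity_eq_lintegral_mul _ (hs.mul hw) hms.lintegral_kernel_prod_right']
  refine lintegral_congr fun ω => ?_
  have h2 : ∫⁻ x, t.indicator (v ∘ Prod.snd) (Prod.swap (ω, x)) ∂(Qs.condKernel ω) =
      v ω * Qs.condKernel ω ((fun x => (x, ω)) ⁻¹' t) := by
    rw [← lintegral_indicator_const (ht.preimage (by fun_prop))]
    rfl
  simp only [Pi.mul_apply]
  change s ω * w ω * (∫⁻ x, t.indicator (v ∘ Prod.snd) (Prod.swap (ω, x)) ∂(Qs.condKernel ω)) = _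
  rw [h2, mul_assoc, ← mul_assoc (w ω), hwv, one_mul]
  rfl

end Campbell

/-! ### From pointwise to mean optimality -/

section RandomSemicouplings

variable {Ω : Type*} [MeasurableSpace Ω] {P : Measure Ω}

theorem isDiagonalSemicoupling_campbell {M : Type*} [MeasurableSpace M]
    {L N : ProbabilityTheory.Kernel Ω M} {K : ProbabilityTheory.Kernel Ω (M × M)}
    [ProbabilityTheory.IsSFiniteKernel L] [ProbabilityTheory.IsSFiniteKernel N]
    [ProbabilityTheory.IsSFiniteKernel K] (h : ∀ᵐ ω ∂P, IsSemicoupling (L ω) (N ω) (K ω)) :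
    IsDiagonalSemicoupling (campbell P L) (campbell P N) (campbell P K) := by
  constructor
  · rw [map_campbell measurable_fst]
    refine campbell_mono_ae (h.mono fun ω hω => ?_)
    rw [ProbabilityTheory.Kernel.map_apply _ measurable_fst]
    exact hω.fst_le
  · rw [map_campbell measurable_snd]
    refine campbell_congr_ae (h.mono fun ω hω => ?_)
    rw [ProbabilityTheory.Kernel.map_apply _ measurable_snd]
    exact hω.snd_eq

theorem meanCost_campbell {M : Type*} [PseudoMetricSpace M] [SecondCountableTopology M]
    [MeasurableSpace M] [BorelSpace M] {ϑ : ℝ≥0 → ℝ≥0} (hϑ : Continuous ϑ)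
    (K : ProbabilityTheory.Kernel Ω (M × M)) [ProbabilityTheory.IsSFiniteKernel K] :
    meanCost ϑ (campbell P K) = ∫⁻ ω, transportCost ϑ (K ω) ∂P := by
  have : Measurable fun p : (M × M) × Ω => (ϑ (nndist p.1.1 p.1.2) : ℝ≥0∞) :=
    ((hϑ.comp continuous_nndist).measurable.coe_nnreal_ennreal).comp measurable_fst
  rw [meanCost, lintegral_campbell P K this]
  rfl

variable {M : Type*} [MetricSpace M] [ProperSpace M] [Nonempty M] [MeasurableSpace M]
  [BorelSpace M] [IsProbabilityMeasure P]

/-- Diagonal semicouplings of Campbell measures are mixtures of semicouplings. -/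
theorem exists_eq_campbell_of_isDiagonalSemicoupling {L N : ProbabilityTheory.Kernel Ω M}
    (hL : ∀ ω, IsLocallyFiniteMeasure (L ω)) (hN : ∀ ω, IsFiniteMeasure (N ω))
    {R : Measure ((M × M) × Ω)}
    (hR : IsDiagonalSemicoupling (campbell P L) (campbell P N) R) :
    ∃ r : ProbabilityTheory.Kernel Ω (M × M), (∀ ω, IsFiniteMeasure (r ω)) ∧
      R = campbell P r ∧ ∀ᵐ ω ∂P, IsSemicoupling (L ω) (N ω) (r ω) := by
  have hsL := isSFiniteKernel_of_isLocallyFiniteMeasure L hL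
  have hsN := isSFiniteKernel_of_isFiniteMeasure N hN
  have hsnd : R.map Prod.snd = P.withDensity fun ω => N ω univ := by
    rw [← map_snd_campbell, ← hR.snd_eq, Measure.map_map measurable_snd (by fun_prop)]
    rfl
  obtain ⟨r, hr, rfl⟩ := exists_eq_campbell (N.measurable_coe MeasurableSet.univ)
    (fun ω => measure_ne_top _ _) hsnd
  have hsr := isSFiniteKernel_of_isFiniteMeasure r hr
  refine ⟨r, hr, rfl, ?_⟩
  have h1 := hR.fst_le
  have h2 := hR.snd_eq
  rw [map_campbell measurable_fst] at h1
  rw [map_campbell measurable_snd] at h2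
  have hreg : ∀ ω, (r.map Prod.snd ω).OuterRegular := fun ω => by
    rw [ProbabilityTheory.Kernel.map_apply _ measurable_snd]
    infer_instance
  filter_upwards [ae_le_of_campbell_le (ae_of_all _ fun ω => by have := hL ω; infer_instance) h1,
    ae_le_of_campbell_le (ae_of_all _ fun ω => by infer_instance) h2.le,
    ae_le_of_campbell_le (ae_of_all _ hreg) h2.ge] with ω h3 h4 h5
  rw [ProbabilityTheory.Kernel.map_apply _ measurable_fst] at h3
  rw [ProbabilityTheory.Kernel.map_apply _ measurable_snd] at h4 h5
  exact ⟨h3, le_antisymm h4 h5⟩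

/-- Encoding points as numbers in `[0, 1]` allows a map into `X` to be recovered from a density. -/
theorem exists_measurableEmbedding_le_one (X : Type*) [MeasurableSpace X] [StandardBorelSpace X] :
    ∃ e : X → ℝ≥0∞, MeasurableEmbedding e ∧ ∀ x, e x ≤ 1 := by
  have hemb := measurableEmbedding_embeddingReal X
  refine ⟨fun x => ENNReal.ofReal (Real.sigmoid (embeddingReal X x)),
    Measurable.measurableEmbedding ?_ ?_, fun x => ?_⟩
  · exact (Real.sigmoid_strictMono.monotone.measurable.comp hemb.measurable).ennreal_ofReal
  · intro x y hxy
    have h1 := (ENNReal.ofReal_eq_ofReal_iff (Real.sigmoid_nonneg _) (Real.sigmoid_nonneg _)).1 hxy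
    exact hemb.injective (Real.sigmoid_strictMono.injective h1)
  · exact ENNReal.ofReal_le_one.2 (Real.sigmoid_le_one _)

/-- A random measure concentrated on graphs is concentrated on the graph of a jointly measurable
map. -/
theorem exists_measurable_graph {K : ProbabilityTheory.Kernel Ω (M × M)}
    (hK : ∀ ω, IsFiniteMeasure (K ω))
    (hgraph : ∀ᵐ ω ∂P, ∃ T : M → M, Measurable T ∧ ∀ᵐ p ∂(K ω), p.2 = T p.1) :
    ∃ T : M × Ω → M, Measurable T ∧
      ∀ᵐ ω ∂P, K ω = ((K ω).map Prod.fst).map fun x => (x, T (x, ω)) := by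
  have hsK := isSFiniteKernel_of_isFiniteMeasure K hK
  obtain ⟨e, he, he1⟩ := exists_measurableEmbedding_le_one M
  obtain ⟨i, hi, hie⟩ := he.exists_measurable_extend measurable_id fun _ => ‹Nonempty M›
  -- On the graph of `T`, weighting by `e p.2` gives a first marginal with density `e ∘ T`. A
  -- jointly measurable version `E` of this density, decoded by `i`, is the required map.
  let f : Ω → M × M → ℝ≥0∞ := fun _ p => e p.2
  have hf : Measurable (Function.uncurry f) := he.measurable.comp (measurable_snd.comp measurable_snd)
  have hftop : ∀ ω p, f ω p ≠ ∞ := fun ω p => ((he1 _).trans_lt ENNReal.one_lt_top).ne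
  have := ProbabilityTheory.Kernel.IsSFiniteKernel.withDensity K hftop
  have hwle : ∀ ω, (K ω).withDensity (f ω) ≤ K ω := fun ω => by
    conv_rhs => rw [← withDensity_one (μ := K ω)]
    exact withDensity_mono (ae_of_all _ fun p => he1 _)
  have hle : ∀ ω, (K.withDensity f).map Prod.fst ω ≤ K.map Prod.fst ω := fun ω => by
    rw [ProbabilityTheory.Kernel.map_apply _ measurable_fst,
      ProbabilityTheory.Kernel.map_apply _ measurable_fst,
      ProbabilityTheory.Kernel.withDensity_apply _ hf]
    exact Measure.map_mono (hwle ω) measurable_fst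
  have hfin : ∀ ω, IsFiniteMeasure (K.map Prod.fst ω) := fun ω => by
    rw [ProbabilityTheory.Kernel.map_apply _ measurable_fst]
    infer_instance
  obtain ⟨E, hE, hE1, hEeq⟩ := exists_measurable_density (P := P)
    (fun ω => by have := isFiniteMeasure_of_le _ (hle ω); infer_instance)
    (fun ω => by infer_instance) (ae_of_all _ hle)
  refine ⟨i ∘ E, hi.comp hE, ?_⟩
  filter_upwards [hgraph, hEeq] with ω ⟨T, hT, hTgraph⟩ hω
  rw [ProbabilityTheory.Kernel.map_apply _ measurable_fst,
    ProbabilityTheory.Kernel.map_apply _ measurable_fst,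
    ProbabilityTheory.Kernel.withDensity_apply _ hf] at hω
  set α := (K ω).map Prod.fst
  have hgm : Measurable fun x => (x, T x) := by fun_prop
  have hKα : K ω = α.map fun x => (x, T x) := eq_map_graph hT hTgraph
  have h1 : ((K ω).withDensity (f ω)).map Prod.fst = α.withDensity (e ∘ T) := by
    change ((K ω).withDensity (e ∘ Prod.snd)).map Prod.fst = _
    rw [hKα, ← map_withDensity_comp hgm _ (he.measurable.comp measurable_snd)]
    exact map_fst_map_graph hT
  have h2 : (e ∘ T) =ᵐ[α] fun x => E (x, ω) := by
    refine (withDensity_eq_iff (he.measurable.comp hT).aemeasurable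
      (hE.comp measurable_prodMk_right).aemeasurable ?_).1 (h1.symm.trans hω)
    refine ((lintegral_mono fun x => he1 (T x)).trans_lt ?_).ne
    simp
  conv_lhs => rw [hKα]
  refine Measure.map_congr ?_
  filter_upwards [h2] with x hx
  simp only [Function.comp_apply] at hx ⊢
  rw [← hx]
  exact Prod.ext rfl (congrFun hie (T x)).symm

/-- Existence, uniqueness and structure of optimal semicouplings of random measures on a proper
metric space. -/
theorem exists_optimal_semicoupling {m : Measure M} {lam mu : Ω → Measure M}
    (hlam : IsRandomMeasure lam) (hmu : IsRandomMeasure mu)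
    (hlam_ac : ∀ᵐ ω ∂P, lam ω ≪ m) (hlam_top : ∀ᵐ ω ∂P, lam ω univ = ∞)
    {ϑ : ℝ≥0 → ℝ≥0} (hϑ : IsScaleFunction ϑ) (hMonge : UniqueMongeSolutions m ϑ)
    {A : Set M} (hA : MeasurableSet A) (hA_bdd : Bornology.IsBounded A) :
    ∃ Q : Measure ((M × M) × Ω),
      IsMinimizer {R | IsDiagonalSemicoupling (campbell P lam)
        (campbell P fun ω => (mu ω).restrict A) R} (meanCost ϑ) Q ∧
      (meanCost ϑ Q < ∞ →
        IsUniqueMinimizer {R | IsDiagonalSemicoupling (campbell P lam)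
          (campbell P fun ω => (mu ω).restrict A) R} (meanCost ϑ) Q) ∧
      ∃ q : Ω → Measure (M × M), IsRandomMeasure q ∧
        Q = campbell P q ∧
        (∀ᵐ ω ∂P, IsUniqueMinimizer {r | IsSemicoupling (lam ω) ((mu ω).restrict A) r}
          (transportCost ϑ) (q ω)) ∧
        (∃ (T : M × Ω → M) (ρ : M × Ω → ℝ≥0∞), Measurable T ∧ Measurable ρ ∧ (∀ p, ρ p ≤ 1) ∧
          ∀ᵐ ω ∂P, q ω =
            ((lam ω).withDensity fun x => ρ (x, ω)).map fun x => (x, T (x, ω))) ∧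
        meanCost ϑ Q = ∫⁻ ω, transportCost ϑ (q ω) ∂P := by
  obtain ⟨x0⟩ := id ‹Nonempty M›
  obtain ⟨r0, hr0⟩ := hA_bdd.subset_closedBall x0
  have hAr : A ⊆ Metric.closedBall x0 (r0.toNNReal : ℝ) :=
    hr0.trans (Metric.closedBall_subset_closedBall (Real.le_coe_toNNReal r0))
  obtain ⟨L, rfl⟩ : ∃ L : ProbabilityTheory.Kernel Ω M, L = lam := ⟨⟨lam, hlam.measurable⟩, rfl⟩
  have hnu : Measurable fun ω => (mu ω).restrict A := by
    refine Measure.measurable_of_measurable_coe _ fun s hs => ?_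
    simp only [Measure.restrict_apply hs]
    exact Measure.measurable_measure.1 hmu.measurable _ (hs.inter hA)
  obtain ⟨N, hN⟩ : ∃ N : ProbabilityTheory.Kernel Ω M, N = fun ω => (mu ω).restrict A :=
    ⟨⟨_, hnu⟩, rfl⟩
  have hNω : ∀ ω, (mu ω).restrict A = N ω := fun ω => (congrFun hN ω).symm
  have hnu_fin : ∀ ω, IsFiniteMeasure (N ω) := fun ω => by
    have := hmu.locallyFinite ω
    refine ⟨?_⟩
    rw [← hNω, Measure.restrict_apply_univ]
    exact (measure_mono hAr).trans_lt (isCompact_closedBall _ _).measure_lt_top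
  have hnu_supp : ∀ ω, N ω (Metric.closedBall x0 (r0.toNNReal : ℝ))ᶜ = 0 := fun ω => by
    rw [← hNω, Measure.restrict_apply measurableSet_closedBall.compl]
    convert measure_empty (μ := mu ω)
    ext x
    simp only [mem_inter_iff, mem_compl_iff, mem_empty_iff_false, iff_false, not_and]
    exact fun hx hxA => hx (hAr hxA)
  simp only [hNω]
  obtain ⟨q, hq, hq_fin, hq_min⟩ := exists_measurable_isMinimizer P L.measurable
    hlam.locallyFinite N.measurable hnu_fin x0 r0.toNNReal hnu_supp hlam_ac hlam_top hϑ hMonge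
  obtain ⟨K, rfl⟩ : ∃ K : ProbabilityTheory.Kernel Ω (M × M), K = q := ⟨⟨q, hq⟩, rfl⟩
  have hsL := isSFiniteKernel_of_isLocallyFiniteMeasure L hlam.locallyFinite
  have hsN := isSFiniteKernel_of_isFiniteMeasure N hnu_fin
  have hsK := isSFiniteKernel_of_isFiniteMeasure K hq_fin
  have hcost : meanCost ϑ (campbell P K) = ∫⁻ ω, transportCost ϑ (K ω) ∂P :=
    meanCost_campbell hϑ.continuous K
  have hQ : IsMinimizer {R | IsDiagonalSemicoupling (campbell P L) (campbell P N) R}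
      (meanCost ϑ) (campbell P K) := by
    refine ⟨isDiagonalSemicoupling_campbell (hq_min.mono fun ω hω => hω.1.1.1), fun R hR => ?_⟩
    obtain ⟨r, hr, rfl, hrsc⟩ :=
      exists_eq_campbell_of_isDiagonalSemicoupling hlam.locallyFinite hnu_fin hR
    have hsr := isSFiniteKernel_of_isFiniteMeasure r hr
    rw [hcost, meanCost_campbell hϑ.continuous r]
    refine lintegral_mono_ae ?_
    filter_upwards [hq_min, hrsc] with ω h1 h2
    exact h1.1.1.2 _ h2
  refine ⟨campbell P K, hQ, fun hfin => ⟨hQ, fun R hR => ?_⟩, K,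
    ⟨hq, fun ω => by infer_instance⟩, rfl, hq_min.mono fun ω hω => hω.1, ?_, hcost⟩
  · obtain ⟨r, hr, rfl, hrsc⟩ :=
      exists_eq_campbell_of_isDiagonalSemicoupling hlam.locallyFinite hnu_fin hR.1
    have hsr := isSFiniteKernel_of_isFiniteMeasure r hr
    have heq : meanCost ϑ (campbell P r) = meanCost ϑ (campbell P K) :=
      le_antisymm (hR.2 _ hQ.1) (hQ.2 _ hR.1)
    rw [hcost, meanCost_campbell hϑ.continuous r] at heq
    have hmeas : Measurable fun ω => transportCost ϑ (r ω) :=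
      (measurable_cost hϑ.continuous).lintegral_kernel
    -- Finiteness of the mean cost enters here: ordered functions with equal finite integrals agree
    -- almost everywhere.
    have hae : ∀ᵐ ω ∂P, transportCost ϑ (K ω) = transportCost ϑ (r ω) := by
      refine ae_eq_of_ae_le_of_lintegral_le ?_ (hcost ▸ hfin.ne) hmeas.aemeasurable heq.le
      filter_upwards [hq_min, hrsc] with ω h1 h2
      exact h1.1.1.2 _ h2
    refine campbell_congr_ae ?_
    filter_upwards [hq_min, hrsc, hae] with ω h1 h2 h3
    exact h1.1.2 _ ⟨h2, fun b hb => h3 ▸ h1.1.1.2 b hb⟩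
  · have hgraph : ∀ᵐ ω ∂P, ∃ T : M → M, Measurable T ∧ ∀ᵐ p ∂(K ω), p.2 = T p.1 := by
      filter_upwards [hq_min, hlam_ac] with ω h1 hac
      have := hlam.locallyFinite ω
      exact exists_graph_of_isMinimizer hac hMonge
        ⟨_, isCompact_closedBall x0 _, hnu_supp ω⟩ h1.1.1 h1.2
    obtain ⟨T, hT, hTeq⟩ := exists_measurable_graph hq_fin hgraph
    have hfst_fin : ∀ ω, IsFiniteMeasure (K.map Prod.fst ω) := fun ω => by
      have := hq_fin ω
      rw [ProbabilityTheory.Kernel.map_apply _ measurable_fst]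
      exact Measure.isFiniteMeasure_map (K ω) _
    obtain ⟨ρ, hρ, hρ1, hρeq⟩ := exists_measurable_density (P := P) (κ := K.map Prod.fst) (η := L)
      (fun ω => by infer_instance) hlam.locallyFinite (by
        filter_upwards [hq_min] with ω h1
        rw [ProbabilityTheory.Kernel.map_apply _ measurable_fst]
        exact h1.1.1.1.fst_le)
    refine ⟨T, ρ, hT, hρ, hρ1, ?_⟩
    filter_upwards [hTeq, hρeq] with ω h1 h2
    rw [ProbabilityTheory.Kernel.map_apply _ measurable_fst] at h2
    rw [h2] at h1
    exact h1

end RandomSemicouplings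

/-! ### Properness of the manifold -/

section Proper

theorem properSpace_of_isCompact_closedBall_of_approx {M : Type*} [MetricSpace M] {ε : ℝ}
    (hε : 0 < ε) (hcpt : ∀ z : M, IsCompact (Metric.closedBall z ε))
    (hlen : ∀ (x y : M) (s t : ℝ), 0 ≤ s → 0 < t → dist x y < s + t →
      ∃ z, dist x z ≤ s ∧ dist z y < t) : ProperSpace M := by
  have key : ∀ (x : M) (n : ℕ), IsCompact (Metric.closedBall x (n * (ε / 2))) := by
    intro x n
    induction n with
    | zero => simp
    | succ n ih =>
      obtain ⟨t, -, htfin, ht⟩ := ih.finite_cover_balls (e := ε / 4) (by linarith)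
      refine (htfin.isCompact_biUnion fun c _ => hcpt c).of_isClosed_subset
        Metric.isClosed_closedBall fun y hy => ?_
      rw [Metric.mem_closedBall, dist_comm] at hy
      push_cast at hy
      -- The step `3ε/4` exceeds the increment `ε/2`, giving the strict inequality, and with the net
      -- radius `ε/4` it adds up to `ε`.
      obtain ⟨z, hz, hzy⟩ := hlen x y (n * (ε / 2)) (3 / 4 * ε) (by positivity) (by linarith)
        (by linarith)
      obtain ⟨c, hc, hzc⟩ := mem_iUnion₂.1 (ht (Metric.mem_closedBall'.2 hz))
      refine mem_iUnion₂.2 ⟨c, hc, ?_⟩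
      rw [Metric.mem_closedBall, dist_comm]
      have h1 := dist_triangle c z y
      rw [Metric.mem_ball, dist_comm] at hzc
      linarith
  refine ⟨fun x r => ?_⟩
  obtain ⟨n, hn⟩ := exists_nat_ge (r / (ε / 2))
  exact (key x n).of_isClosed_subset Metric.isClosed_closedBall
    (Metric.closedBall_subset_closedBall ((div_le_iff₀ (by linarith)).1 hn))

/-- In a Riemannian manifold, points can be interpolated approximately. -/
theorem exists_dist_le_dist_lt_of_isRiemannianManifold (n : ℕ) {M : Type*} [MetricSpace M]
    [ChartedSpace (EuclideanSpace ℝ (Fin n)) M]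
    [IsManifold (𝓡 n) ((⊤ : ℕ∞) : WithTop ℕ∞) M]
    [RiemannianBundle (fun x : M => TangentSpace (𝓡 n) x)] [IsRiemannianManifold (𝓡 n) M]
    (x y : M) (s t : ℝ) (hs : 0 ≤ s) (ht : 0 < t) (hxy : dist x y < s + t) :
    ∃ z, dist x z ≤ s ∧ dist z y < t := by
  by_cases hle : dist x y ≤ s
  · exact ⟨y, hle, by simpa using ht⟩
  have h1 : riemannianEDist (𝓡 n) x y < ENNReal.ofReal (s + t) := by
    rw [← IsRiemannianManifold.out (I := 𝓡 n) x y, edist_dist]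
    exact (ENNReal.ofReal_lt_ofReal_iff (by linarith)).2 hxy
  obtain ⟨γ, hγ0, hγ1, hγ, hlen⟩ := exists_lt_of_riemannianEDist_lt h1
  -- The point sought lies on a nearly shortest curve, at distance exactly `s` from `x`; the length
  -- of the rest leaves less than `t`.
  have hcont : ContinuousOn (fun τ => dist x (γ τ)) (Icc 0 1) :=
    (continuous_const.dist continuous_id).comp_continuousOn hγ.continuousOn
  obtain ⟨τ, hτ, hτs⟩ := intermediate_value_Icc zero_le_one hcont
    (show s ∈ Icc (dist x (γ 0)) (dist x (γ 1)) by
      rw [hγ0, hγ1, dist_self]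
      exact ⟨hs, (not_le.1 hle).le⟩)
  have hτs' : dist x (γ τ) = s := hτs
  refine ⟨γ τ, hτs'.le, ?_⟩
  have h2 : edist x (γ τ) ≤ pathELength (𝓡 n) γ 0 τ := by
    rw [IsRiemannianManifold.out (I := 𝓡 n) x (γ τ)]
    exact riemannianEDist_le_pathELength (hγ.mono (Icc_subset_Icc_right hτ.2)) hγ0 rfl hτ.1
  have h3 : edist (γ τ) y ≤ pathELength (𝓡 n) γ τ 1 := by
    rw [IsRiemannianManifold.out (I := 𝓡 n) (γ τ) y]
    exact riemannianEDist_le_pathELength (hγ.mono (Icc_subset_Icc_left hτ.1)) rfl hγ1 hτ.2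
  have h4 : edist x (γ τ) + edist (γ τ) y < ENNReal.ofReal (s + t) := by
    refine (add_le_add h2 h3).trans_lt ?_
    rwa [pathELength_add hτ.1 hτ.2]
  rw [edist_dist, edist_dist, ← ENNReal.ofReal_add dist_nonneg dist_nonneg,
    ENNReal.ofReal_lt_ofReal_iff (by linarith), hτs'] at h4
  linarith

variable {M : Type*} [MetricSpace M] (G : Type*) [Group G] [MulAction G M] [IsIsometricSMul G M]

/-- Under a cocompact group action, an open cover by translates of members of a directed family
reduces to the translates of one member. -/
theorem exists_forall_mem_smul_of_compactSpace_quotient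
    (hG : CompactSpace (MulAction.orbitRel.Quotient G M)) {ι : Type*} (U : ι → Set M)
    (hU : ∀ i, IsOpen (U i)) (hcover : ⋃ i, U i = univ) :
    ∃ t : Finset ι, ∀ x : M, ∃ g : G, ∃ i ∈ t, ∃ y ∈ U i, g • y = x := by
  let q : M → MulAction.orbitRel.Quotient G M := Quotient.mk _
  have hq : IsOpenMap q := isOpenMap_quotient_mk'_mul
  obtain ⟨t, ht⟩ := isCompact_univ.elim_finite_subcover (fun i => q '' U i)
    (fun i => hq _ (hU i)) (fun z _ => by
      obtain ⟨x, rfl⟩ := Quotient.exists_rep z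
      obtain ⟨i, hi⟩ := mem_iUnion.1 (hcover ▸ mem_univ x)
      exact mem_iUnion.2 ⟨i, x, hi, rfl⟩)
  refine ⟨t, fun x => ?_⟩
  obtain ⟨i, hi, y, hy, hyx⟩ := mem_iUnion₂.1 (ht (mem_univ (q x)))
  obtain ⟨g, hg⟩ : x ∈ MulAction.orbit G y := MulAction.orbitRel_apply.1 (Quotient.exact hyx.symm)
  exact ⟨g, i, hi, y, hy, hg⟩

/-- Translates of finitely many half-radius balls cover `M`; half the least radius works at every
point because isometries preserve compact balls. -/
theorem exists_pos_forall_isCompact_closedBall [LocallyCompactSpace M] [Nonempty M]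
    (hG : CompactSpace (MulAction.orbitRel.Quotient G M)) :
    ∃ ε : ℝ, 0 < ε ∧ ∀ z : M, IsCompact (Metric.closedBall z ε) := by
  have h1 : ∀ x : M, ∃ r : ℝ, 0 < r ∧ IsCompact (Metric.closedBall x r) := fun x => by
    obtain ⟨K, hK, hxK⟩ := exists_compact_mem_nhds x
    obtain ⟨r, hr, hrK⟩ := Metric.nhds_basis_closedBall.mem_iff.1 hxK
    exact ⟨r, hr, hK.of_isClosed_subset Metric.isClosed_closedBall hrK⟩
  choose r hr hrc using h1
  obtain ⟨t, ht⟩ := exists_forall_mem_smul_of_compactSpace_quotient G hG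
    (fun x => Metric.ball x (r x / 2)) (fun _ => Metric.isOpen_ball)
    (eq_univ_of_forall fun x => mem_iUnion.2 ⟨x, Metric.mem_ball_self (by linarith [hr x])⟩)
  obtain ⟨x0⟩ := ‹Nonempty M›
  have htne : t.Nonempty := by
    obtain ⟨g, i, hi, -⟩ := ht x0
    exact ⟨i, hi⟩
  obtain ⟨i0, -, hi0⟩ := t.exists_min_image r htne
  refine ⟨r i0 / 2, by linarith [hr i0], fun z => ?_⟩
  obtain ⟨g, i, hi, y, hy, rfl⟩ := ht z
  rw [← Metric.smul_closedBall]
  refine IsCompact.smul g ((hrc i).of_isClosed_subset Metric.isClosed_closedBall ?_)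
  refine Metric.closedBall_subset_closedBall' ?_
  have := hi0 i hi
  rw [Metric.mem_ball] at hy
  linarith

end Proper

/-! ### Infinite mass by stationarity -/

section InfiniteMass

/-- A non-zero equivariant random measure has infinite mass. -/
theorem ae_measure_univ_eq_top {M : Type*} [MetricSpace M] [ProperSpace M] [NoncompactSpace M]
    [Nonempty M] [MeasurableSpace M] [BorelSpace M]
    {G : Type*} [Group G] [MulAction G M] [IsIsometricSMul G M]
    (hG_disc : ∀ (x : M) (K : Set M), IsCompact K → {g : G | g • x ∈ K}.Finite)
    (hG_cocompact : CompactSpace (MulAction.orbitRel.Quotient G M))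
    {Ω : Type*} [MeasurableSpace Ω] {P : Measure Ω} [IsProbabilityMeasure P] {θ : G → Ω → Ω}
    (hθ_stat : ∀ g : G, MeasurePreserving (θ g) P P)
    {lam : Ω → Measure M} (hlam : Measurable lam) (hlam_equiv : IsEquivariant θ lam)
    (hlam_ne : ∀ᵐ ω ∂P, lam ω ≠ 0) : ∀ᵐ ω ∂P, lam ω univ = ∞ := by
  obtain ⟨x0⟩ := ‹Nonempty M›
  have hcountable : Countable G := by
    rw [← countable_univ_iff]
    have : (univ : Set G) = ⋃ n : ℕ, {g : G | g • x0 ∈ Metric.closedBall x0 n} := by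
      refine (eq_univ_of_forall fun g => ?_).symm
      obtain ⟨n, hn⟩ := exists_nat_ge (dist (g • x0) x0)
      exact mem_iUnion.2 ⟨n, hn⟩
    rw [this]
    exact countable_iUnion fun n => (hG_disc x0 _ (isCompact_closedBall _ _)).countable
  obtain ⟨R, hR⟩ : ∃ R : ℝ, ∀ x : M, ∃ g : G, dist x (g • x0) ≤ R := by
    obtain ⟨t, ht⟩ := exists_forall_mem_smul_of_compactSpace_quotient G hG_cocompact
      (fun n : ℕ => Metric.ball x0 n) (fun _ => Metric.isOpen_ball) (Metric.iUnion_ball_nat x0)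
    obtain ⟨N, hN⟩ := t.bddAbove
    refine ⟨N, fun x => ?_⟩
    obtain ⟨g, i, hi, y, hy, rfl⟩ := ht x
    refine ⟨g, ?_⟩
    rw [dist_smul]
    exact (Metric.mem_ball.1 hy).le.trans (Nat.cast_le.2 (hN hi))
  have hlam_coe : ∀ {s : Set M}, MeasurableSet s → Measurable fun ω => lam ω s := fun hs =>
    Measure.measurable_measure.1 hlam _ hs
  have hmeas : Measurable fun ω => (lam ω univ)⁻¹ • lam ω := by
    refine Measure.measurable_of_measurable_coe _ fun s hs => ?_
    exact (hlam_coe MeasurableSet.univ).inv.mul (hlam_coe hs)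
  -- As `∞⁻¹ = 0`, realizations of infinite mass contribute nothing, so `η = 0` says that almost
  -- surely the mass is zero or infinite.
  set η : Measure M := P.bind fun ω => (lam ω univ)⁻¹ • lam ω
  have hη : ∀ {s : Set M}, MeasurableSet s → η s = ∫⁻ ω, (lam ω univ)⁻¹ * lam ω s ∂P := fun hs => by
    rw [Measure.bind_apply hs hmeas.aemeasurable]
    rfl
  have hdens : ∀ {s : Set M}, MeasurableSet s → Measurable fun ω => (lam ω univ)⁻¹ * lam ω s :=
    fun hs => (hlam_coe MeasurableSet.univ).inv.mul (hlam_coe hs)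
  have hη_fin : IsFiniteMeasure η := by
    refine ⟨?_⟩
    rw [hη MeasurableSet.univ]
    calc _ ≤ ∫⁻ _, 1 ∂P := lintegral_mono fun ω => ENNReal.inv_mul_le_one _
      _ < ∞ := by simp
  have hinv : ∀ g : G, η (Metric.closedBall (g • x0) R) = η (Metric.closedBall x0 R) := fun g => by
    rw [hη measurableSet_closedBall, hη measurableSet_closedBall,
      ← (hθ_stat g).lintegral_comp (hdens measurableSet_closedBall)]
    refine lintegral_congr fun ω => ?_
    have h1 := hlam_equiv g ω univ MeasurableSet.univ
    have h2 := hlam_equiv g ω _ (measurableSet_closedBall (x := x0) (ε := R))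
    rw [smul_set_univ] at h1
    rw [Metric.smul_closedBall] at h2
    rw [h1, h2]
  have hzero : η (Metric.closedBall x0 R) = 0 := by
    have hlim : Tendsto (fun n : ℕ => η (Metric.closedBall x0 n)ᶜ) atTop (𝓝 0) := by
      have : ⋂ n : ℕ, (Metric.closedBall x0 (n : ℝ))ᶜ = ∅ := by
        rw [← compl_iUnion, Metric.iUnion_closedBall_nat, compl_univ]
      rw [← measure_empty (μ := η), ← this]
      exact tendsto_measure_iInter_atTop
        (fun n => measurableSet_closedBall.compl.nullMeasurableSet)
        (fun a b hab => compl_subset_compl.2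
          (Metric.closedBall_subset_closedBall (Nat.cast_le.2 hab))) ⟨0, measure_ne_top _ _⟩
    refine le_antisymm (ge_of_tendsto' hlim fun n => ?_) zero_le
    -- One `R` is lost between `z` and the nearby orbit point, another inside the ball around that
    -- point, which therefore avoids the ball of radius `n`.
    obtain ⟨z, hz⟩ : ∃ z : M, (n : ℝ) + 2 * R < dist z x0 := by
      by_contra! h
      refine noncompact_univ M ((isCompact_closedBall x0 ((n : ℝ) + 2 * R)).of_isClosed_subset
        isClosed_univ fun z _ => h z)
    obtain ⟨g, hg⟩ := hR z
    rw [← hinv g]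
    refine measure_mono fun w hw hw' => ?_
    rw [Metric.mem_closedBall] at hw hw'
    have h1 := dist_triangle z (g • x0) x0
    have h2 := dist_triangle (g • x0) w x0
    rw [dist_comm (g • x0) w] at h2
    linarith
  have huniv : η univ = 0 := by
    have : (univ : Set M) = ⋃ g : G, Metric.closedBall (g • x0) R :=
      (eq_univ_of_forall fun x => mem_iUnion.2 (hR x)).symm
    rw [this]
    exact measure_iUnion_null fun g => (hinv g).trans hzero
  rw [hη MeasurableSet.univ, lintegral_eq_zero_iff (hdens MeasurableSet.univ)] at huniv
  filter_upwards [huniv, hlam_ne] with ω h1 h2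
  rcases mul_eq_zero.1 h1 with h | h
  · exact ENNReal.inv_eq_zero.1 h
  · exact absurd (Measure.measure_univ_eq_zero.1 h) h2

end InfiniteMass
-- The main theorem
theorem theorem2
    -- a complete connected non-compact smooth Riemannian manifold `M` without boundary
    (n : ℕ) (M : Type*) [MetricSpace M] [ChartedSpace (EuclideanSpace ℝ (Fin n)) M]
    [IsManifold (𝓡 n) ((⊤ : ℕ∞) : WithTop ℕ∞) M]
    [RiemannianBundle (fun x : M => TangentSpace (𝓡 n) x)]
    [IsContMDiffRiemannianBundle (𝓡 n) ((⊤ : ℕ∞) : WithTop ℕ∞) (EuclideanSpace ℝ (Fin n))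
      (fun x : M => TangentSpace (𝓡 n) x)]
    [IsRiemannianManifold (𝓡 n) M]
    [CompleteSpace M] [ConnectedSpace M] [NoncompactSpace M]
    [MeasurableSpace M] [BorelSpace M]
    -- a group of isometries that acts properly discontinuously, cocompactly and freely
    (G : Type*) [Group G] [MulAction G M] [IsIsometricSMul G M]
    (hG_disc : ∀ (x : M) (K : Set M), IsCompact K → {g : G | g • x ∈ K}.Finite)
    (hG_cocompact : CompactSpace (MulAction.orbitRel.Quotient G M))
    (hG_free : ∀ (g : G) (x : M), g • x = x → g = 1)
    -- a probability space with a measurable flow that preserves the probability measure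
    (Ω : Type*) [MeasurableSpace Ω] (P : Measure Ω) [IsProbabilityMeasure P]
    (θ : G → Ω → Ω) (hθ_one : ∀ ω, θ 1 ω = ω)
    (hθ_mul : ∀ (g h : G) (ω : Ω), θ g (θ h ω) = θ (g * h) ω)
    (hθ_stat : ∀ g : G, MeasurePreserving (θ g) P P)
    -- the equivariant random measures
    (lam mu : Ω → Measure M) (hlam : IsRandomMeasure lam) (hmu : IsRandomMeasure mu)
    (hlam_equiv : IsEquivariant θ lam) (hmu_equiv : IsEquivariant θ mu)
    (hlam_ac : ∀ᵐ ω ∂P, lam ω ≪ riemannianVolume n M)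
    (hlam_ne : ∀ᵐ ω ∂P, lam ω ≠ 0)
    -- the cost function
    (ϑ : ℝ≥0 → ℝ≥0) (hϑ : IsScaleFunction ϑ)
    (hMonge : UniqueMongeSolutions (riemannianVolume n M) ϑ)
    -- the bounded Borel set
    (A : Set M) (hA : MeasurableSet A) (hA_bdd : Bornology.IsBounded A) :
    ∃ Q : Measure ((M × M) × Ω),
      -- `Q` minimizes the mean cost, and is the only minimizer if the minimum is finite
      IsMinimizer {R | IsDiagonalSemicoupling (campbell P lam)
        (campbell P fun ω => (mu ω).restrict A) R} (meanCost ϑ) Q ∧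
      (meanCost ϑ Q < ∞ →
        IsUniqueMinimizer {R | IsDiagonalSemicoupling (campbell P lam)
          (campbell P fun ω => (mu ω).restrict A) R} (meanCost ϑ) Q) ∧
      ∃ q : Ω → Measure (M × M), IsRandomMeasure q ∧
        -- the disintegration of `Q`
        Q = campbell P q ∧
        (∀ᵐ ω ∂P, IsUniqueMinimizer {r | IsSemicoupling (lam ω) ((mu ω).restrict A) r}
          (transportCost ϑ) (q ω)) ∧
        -- the optimal semicouplings are induced by maps and densities
        (∃ (T : M × Ω → M) (ρ : M × Ω → ℝ≥0∞), Measurable T ∧ Measurable ρ ∧ (∀ p, ρ p ≤ 1) ∧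
          ∀ᵐ ω ∂P, q ω =
            ((lam ω).withDensity fun x => ρ (x, ω)).map fun x => (x, T (x, ω))) ∧
        meanCost ϑ Q = ∫⁻ ω, transportCost ϑ (q ω) ∂P := by
  have hlc : LocallyCompactSpace M := ChartedSpace.locallyCompactSpace (EuclideanSpace ℝ (Fin n)) M
  obtain ⟨ε, hε, hcpt⟩ := exists_pos_forall_isCompact_closedBall G hG_cocompact
  have hproper : ProperSpace M := properSpace_of_isCompact_closedBall_of_approx hε hcpt
    (exists_dist_le_dist_lt_of_isRiemannianManifold n)
  exact exists_optimal_semicoupling hlam hmu hlam_ac (ae_measure_univ_eq_top hG_disc hG_cocompact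
    hθ_stat hlam.measurable hlam_equiv hlam_ne) hϑ hMonge hA hA_bdd
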